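/- Let $d\ge 1$ and $\mathbb N=\{1,2,\dots\}$. For $\mathbf x\in((0,1)\setminus\mathbb Q)^d$ let $\mathbf a_n(\mathbf x)=(a_n(x_1),\dots,a_n(x_d))\in\mathbb N^d$, where $a_n(x_j)$ is the $n$-th partial quotient of the regular continued fraction of $x_j$. Let $$E^{\mathrm{vec}}=\{\mathbf x\in((0,1)\setminus\mathbb Q)^d:\ \mathbf a_m(\mathbf x)\ne\mathbf a_n(\mathbf x)\text{ for all }m\ne n\},$$ $$\mathcal E=\{\mathbf x\in((0,1)\setminus\mathbb Q)^d:\ a_n(x_j)\to\infty\ (n\to\infty)\text{ for each }j\}.$$ For $X\in\{E^{\mathrm{vec}},\mathcal E\}$, $t>L>1$ and $K\subset\mathbb N^d$ put $$R^X_{t,L}(K)=\{\mathbf x\in X:\ \mathbf a_n(\mathbf x)\in K\text{ and }t^n\le\|\mathbf a_n(\mathbf x)\|_\infty<Lt^n\text{ for all }n\ge1\}.$$ With $Q_N=\{1,\dots,N\}^d$, a set $S\subset\mathbb N^d$ has polynomial density of exponent $\alpha\ge1$ if there are $\beta\in\mathbb R$ and $c,C>0$ with $c\,N^{d/\alpha}(\log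 N)^{-\beta}\le|S\cap Q_N|\le C\,N^{d/\alpha}(\log N)^{-\beta}$ for all large $N$. For $A\subset S$ let $\overline d(A\mid S)=\limsup_{N\to\infty}|A\cap Q_N|/|S\cap Q_N|$. We call $R^X_{t,L}(K)$ an extreme seed set associated with $S$ if $S$ is infinite and has polynomial density of exponent $\alpha\ge1$, $K\subset S$ is infinite, $t>L>1$, $R^X_{t,L}(K)\neq\varnothing$, any two distinct elements of $K$ are at $\ell^\infty$-distance at least $2$, $\overline d(K\mid S)=0$, and $\dim_H R^X_{t,L}(K)\ge d/(2\alpha)$. **Proposition.** Let $S\subset\mathbb N^d$ have polynomial density of exponent $\alpha\ge1$. Then there exist $S^\ast\subset S$ with $\overline d(S^\ast\mid S)=0$ and numbers $t_0>L>1$ such that, for every $t\ge t_0$, $R^{E^{\mathrm{vec}}}_{t,L}(S^\ast)$ is an extreme seed set associated with $S$; in particular $S^\ast$ is $2$-separated and $\dim_H R^{E^{\mathrm{vec}}}_{t,L}(S^\ast)\ge d/(2\alpha)$. If in addition there is $K\ge1$ such that $\max_j a_j\le K\min_j a_j$ for all $\mathbf a\in S$, then for these $S^\ast$, $L$ and every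 $t\ge t_0$ $$\dim_H R^{E^{\mathrm{vec}}}_{t,L}(S^\ast)=\frac{d}{2\alpha},$$ and all of this remains true with $\mathcal E$ in place of $E^{\mathrm{vec}}$: $R^{\mathcal E}_{t,L}(S^\ast)$ is an extreme seed set associated with $S$ and $\dim_H R^{\mathcal E}_{t,L}(S^\ast)=d/(2\alpha)$. -/

import Mathlib

open Filter Topology

noncomputable section

namespace CFSeed

/-! ### Coordinatewise continued fraction digits -/

/-- The Gauss map `x ↦ {1 / x}`. -/
def gaussMap (x : ℝ) : ℝ := Int.fract x⁻¹

/-- The partial quotients of `x ∈ (0,1) \ ℚ`, indexed from `0`: `digit x n` is the `(n+1)`-st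
partial quotient `a_{n+1}(x)` of `x = [0; a_1(x), a_2(x), …]`. -/
def digit (x : ℝ) (n : ℕ) : ℕ := ⌊(gaussMap^[n] x)⁻¹⌋₊

/-- `digit` agrees with Mathlib's regular continued fraction expansion. -/
theorem get?_of_eq_digit (x : ℝ) (hx : Irrational x) (hx0 : 0 < x) (hx1 : x < 1) (n : ℕ) :
    (GenContFract.of x).s.get? n = some ⟨1, (digit x n : ℝ)⟩ := by
  have key : ∀ (n : ℕ) (v : ℝ), Irrational v →
      (GenContFract.of v).s.get? n = some ⟨1, (digit (Int.fract v) n : ℝ)⟩ := by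
    intro n
    induction n with
    | zero =>
      intro v hv
      have hne : Int.fract v ≠ 0 := by
        intro h
        rw [Int.fract, sub_eq_zero] at h
        exact hv ⟨(⌊v⌋ : ℚ), by rw [Rat.cast_intCast]; exact h.symm⟩
      have h0 : 0 ≤ (Int.fract v)⁻¹ := inv_nonneg.mpr (Int.fract_nonneg v)
      have h1 := GenContFract.of_s_head hne
      rw [show (GenContFract.of v).s.get? 0 = (GenContFract.of v).s.head from rfl, h1]
      simp only [digit, Function.iterate_zero, id_eq]
      rw [natCast_floor_eq_intCast_floor h0]
    | succ n ih =>
      intro v hv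
      have hf : Irrational (Int.fract v) := by
        rw [Int.fract]; exact hv.sub_intCast _
      rw [GenContFract.of_s_succ, ih _ hf.inv]
      rfl
  have h := key n x hx
  rwa [Int.fract_eq_self.mpr ⟨hx0.le, hx1⟩] at h

variable {d : ℕ}

/-- The digit vector `𝐚_{n+1}(𝐱) = (a_{n+1}(x_1), …, a_{n+1}(x_d))`. -/
def digitVec (x : Fin d → ℝ) (n : ℕ) : Fin d → ℕ := fun j => digit (x j) n

/-! ### Subsets of the lattice of positive integer vectors -/

/-- The vectors all of whose coordinates are positive integers. -/
def posVec (d : ℕ) : Set (Fin d → ℕ) := {v | ∀ j, 1 ≤ v j}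

/-- The box `Q_N = [1, N]^d`. -/
def box (d N : ℕ) : Set (Fin d → ℕ) := {v | ∀ j, 1 ≤ v j ∧ v j ≤ N}

/-- The sup norm `‖v‖_∞` of a vector of natural numbers. -/
def supNorm (v : Fin d → ℕ) : ℕ := Finset.univ.sup v

/-- The vectors with `max_j v_j ≤ K * min_j v_j`. -/
def balanced (d : ℕ) (K : ℝ) : Set (Fin d → ℕ) :=
  {v | v ∈ posVec d ∧ ∀ i j, (v i : ℝ) ≤ K * v j}

/-- Polynomial density of exponent `α`: `|S ∩ Q_N| ≍ N^{d/α} / (log N)^β` for some `β`. -/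
def HasPolyDensity (S : Set (Fin d → ℕ)) (α : ℝ) : Prop :=
  ∃ β c C : ℝ, 0 < c ∧ 0 < C ∧ ∀ᶠ N : ℕ in atTop,
    c * ((N : ℝ) ^ ((d : ℝ) / α) / Real.log N ^ β) ≤ ((S ∩ box d N).ncard : ℝ) ∧
    ((S ∩ box d N).ncard : ℝ) ≤ C * ((N : ℝ) ^ ((d : ℝ) / α) / Real.log N ^ β)

/-- The relative upper density of `A` in `S`, for `A ⊆ S`
(the quotients then lie in `[0, 1]`). -/
def relUpperDensity (A S : Set (Fin d → ℕ)) : ℝ :=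
  limsup (fun N : ℕ => ((A ∩ box d N).ncard : ℝ) / ((S ∩ box d N).ncard : ℝ)) atTop

/-- Distinct elements are at sup-distance at least `2` (`dist` on `Fin d → ℕ` is the
sup-distance): the set contains no nearest neighbour pairs. -/
def TwoSeparated (A : Set (Fin d → ℕ)) : Prop :=
  A.Pairwise fun v w => 2 ≤ dist v w

/-! ### Seed sets

Points live in `Fin d → ℝ` with its sup metric, which is bi-Lipschitz equivalent to the Euclidean
metric and hence gives the same Hausdorff dimension `dimH`. -/

/-- The points of `(0,1)^d` all of whose coordinates are irrational. -/
def irrCube (d : ℕ) : Set (Fin d → ℝ) := {x | ∀ j, Irrational (x j) ∧ 0 < x j ∧ x j < 1}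

/-- The points of `((0,1) \ ℚ)^d` whose digit vectors are pairwise distinct. -/
def injSpace (d : ℕ) : Set (Fin d → ℝ) :=
  {x | x ∈ irrCube d ∧ ∀ m n, m ≠ n → digitVec x m ≠ digitVec x n}

/-- The points of `((0,1) \ ℚ)^d` for which the digits of every coordinate tend to infinity. -/
def divSpace (d : ℕ) : Set (Fin d → ℝ) :=
  {x | x ∈ irrCube d ∧ ∀ j, Tendsto (fun n => digit (x j) n) atTop atTop}

/-- The set of points `𝐱` of the ambient space `X` with
`𝐚_n(𝐱) ∈ K` and `t^n ≤ ‖𝐚_n(𝐱)‖_∞ < L t^n` for all `n ≥ 1`. -/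
def seedSet (X : Set (Fin d → ℝ)) (t L : ℝ) (K : Set (Fin d → ℕ)) : Set (Fin d → ℝ) :=
  {x | x ∈ X ∧ ∀ n : ℕ, digitVec x n ∈ K ∧
    t ^ (n + 1) ≤ (supNorm (digitVec x n) : ℝ) ∧
    (supNorm (digitVec x n) : ℝ) < L * t ^ (n + 1)}

/-- The set `seedSet X t L K` is an extreme seed set associated with `S`, where `S` has polynomial
density of exponent `α`. -/
structure IsExtremeSeedSet (X : Set (Fin d → ℝ)) (S : Set (Fin d → ℕ)) (α t L : ℝ)
    (K : Set (Fin d → ℕ)) : Prop where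
  infinite_ambient : S.Infinite
  subset : K ⊆ S
  infinite : K.Infinite
  one_lt : 1 < L
  lt : L < t
  nonempty : (seedSet X t L K).Nonempty
  one_le : 1 ≤ α
  polyDensity : HasPolyDensity S α
  twoSeparated : TwoSeparated K
  relUpperDensity_eq_zero : relUpperDensity K S = 0
  le_dimH : ENNReal.ofReal ((d : ℝ) / (2 * α)) ≤ dimH (seedSet X t L K)

end CFSeed

end

noncomputable section

namespace CFSeed

/-!
If exactly the first `n` digits of two irrational numbers agree, their distance is the product of
the values of both along `n` steps of the Gauss map, times the distance of the two `n`-th iterates.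
So when the `i`-th digits lie between `b i` and `B i - 1`, and the `n`-th ones differ by at
least `2`, the distance lies between `∏ i ≤ n, (B i)⁻²` and `∏ i < n, (b i)⁻²`. Comparing this
scale with the number `∏ i < n, |A i|` of initial blocks gives the Hausdorff dimension of the set
of points whose `n`-th digit vector lies in `A n`: covers by blocks give the upper bound, and the
mixed radix expansion with radices `|A i|` maps `[0, 1)` into the set with a Hölder inverse, which
gives the lower one.

For a seed set, `A n` consists of the elements of the thin set with norm of order `t ^ n`. These
must number about `t ^ (n * d / α)`, although the thin set has density zero in `S`. This is achieved
by keeping, in geometrically growing annuli, a `2`-separated proportion of `S` that tends to zero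
more slowly than any power of the radius.
-/

/-! ### Products, compactness and inverse Hölder maps -/

theorem bddAbove_range_prod_range {w : ℕ → ℝ} (hw : ∀ i, 0 ≤ w i) (h : ∀ᶠ i in atTop, w i ≤ 1) :
    BddAbove (Set.range fun n => ∏ i ∈ Finset.range n, w i) := by
  obtain ⟨N, hN⟩ := eventually_atTop.mp h
  have hle : ∀ n ≥ N, ∏ i ∈ Finset.range n, w i ≤ ∏ i ∈ Finset.range N, w i := fun n hn => by
    rw [← Finset.prod_range_mul_prod_Ico w hn]
    exact mul_le_of_le_one_right (Finset.prod_nonneg fun i _ => hw i)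
      (Finset.prod_le_one (fun i _ => hw i) fun i hi => hN i (Finset.mem_Ico.mp hi).1)
  exact Filter.IsBoundedUnder.bddAbove_range ⟨_, eventually_map.mpr (eventually_atTop.mpr ⟨N, hle⟩)⟩

theorem exists_prod_range_le_mul_prod_range {u v : ℕ → ℝ} (hu : ∀ i, 0 ≤ u i) (hv : ∀ i, 0 < v i)
    (h : ∀ᶠ i in atTop, u i ≤ v i) :
    ∃ C : NNReal, ∀ n, ∏ i ∈ Finset.range n, u i ≤ C * ∏ i ∈ Finset.range n, v i := by
  obtain ⟨C, hC⟩ := bddAbove_range_prod_range (fun i => div_nonneg (hu i) (hv i).le)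
    (h.mono fun i hi => (div_le_one (hv i)).mpr hi)
  refine ⟨C.toNNReal, fun n => ?_⟩
  rw [← div_le_iff₀ (Finset.prod_pos fun i _ => hv i), ← Finset.prod_div_distrib]
  exact (hC ⟨n, rfl⟩).trans C.le_coe_toNNReal

theorem prod_inv_sq_rpow {ι : Type*} (t : Finset ι) {b : ι → ℝ} (hb : ∀ i, 0 ≤ b i) (s : ℝ) :
    (∏ i ∈ t, (b i ^ 2)⁻¹) ^ s = (∏ i ∈ t, b i ^ (2 * s))⁻¹ := by
  rw [Finset.prod_inv_distrib, Real.inv_rpow (Finset.prod_nonneg fun i _ => by positivity),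
    ← Real.finsetProd_rpow _ _ fun i _ => by positivity]
  exact congrArg _ (Finset.prod_congr rfl fun i _ => by
    rw [Real.rpow_mul (hb i), Real.rpow_two])

theorem tendsto_prod_range_zero_of_tendsto_zero {w : ℕ → ℝ} (hw : ∀ i, w i ≠ 0)
    (h : Tendsto w atTop (𝓝 0)) :
    Tendsto (fun n => ∏ i ∈ Finset.range n, w i) atTop (𝓝 0) := by
  have hprod : ∀ n, ∏ i ∈ Finset.range n, w i ≠ 0 := fun n =>
    Finset.prod_ne_zero_iff.mpr fun i _ => hw i
  refine (summable_of_ratio_test_tendsto_lt_one zero_lt_one (Eventually.of_forall hprod)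
    ?_).tendsto_atTop_zero
  have hratio : ∀ n, ‖∏ i ∈ Finset.range (n + 1), w i‖ / ‖∏ i ∈ Finset.range n, w i‖ = ‖w n‖ :=
    fun n => by
      rw [Finset.prod_range_succ, norm_mul, mul_div_cancel_left₀ _ (norm_ne_zero_iff.mpr (hprod n))]
  simpa only [hratio, norm_zero] using h.norm

theorem mul_dimH_le_dimH_image {X Y : Type*} [EMetricSpace X] [EMetricSpace Y] {g : X → Y}
    {s : Set X} {C r : NNReal} (hr : 0 < r)
    (h : ∀ x ∈ s, ∀ y ∈ s, edist x y ≤ C * edist (g x) (g y) ^ (r : ℝ)) :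
    r * dimH s ≤ dimH (g '' s) := by
  rcases s.eq_empty_or_nonempty with rfl | ⟨x₀, -⟩
  · simp
  have : Nonempty X := ⟨x₀⟩
  have hinj : Set.InjOn g s := fun x hx y hy hxy => by
    simpa [hxy, ENNReal.zero_rpow_of_pos (NNReal.coe_pos.mpr hr)] using h x hx y hy
  have hleft := hinj.leftInvOn_invFunOn
  have hold : HolderOnWith C r (Function.invFunOn g s) (g '' s) := by
    rintro _ ⟨x, hx, rfl⟩ _ ⟨y, hy, rfl⟩
    simpa only [hleft hx, hleft hy] using h x hx y hy
  calc r * dimH s = r * dimH (Function.invFunOn g s '' (g '' s)) := by rw [hleft.image_image]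
    _ ≤ r * (dimH (g '' s) / r) := by gcongr; exact hold.dimH_image_le hr
    _ ≤ dimH (g '' s) := ENNReal.mul_div_le

theorem exists_seq_eq_apply_succ {X : ℕ → Type*} [∀ n, TopologicalSpace (X n)]
    [∀ n, CompactSpace (X n)] [∀ n, T2Space (X n)] [∀ n, Nonempty (X n)]
    {f : ∀ n, X (n + 1) → X n} (hf : ∀ n, Continuous (f n)) :
    ∃ r : ∀ n, X n, ∀ n, r n = f n (r (n + 1)) := by
  let Z : ℕ → Set (∀ n, X n) := fun n => {r | ∀ i < n, r i = f i (r (i + 1))}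
  have hclosed : ∀ n, IsClosed (Z n) := fun n => by
    simp only [Z, Set.ofPred_forall]
    exact isClosed_iInter fun i => isClosed_iInter fun _ =>
      isClosed_eq (continuous_apply i) ((hf i).comp (continuous_apply (i + 1)))
  have hnonempty : ∀ n, (Z n).Nonempty := fun n => by
    suffices h : ∀ k ≤ n, ∃ r : ∀ n, X n, ∀ i < n, n - k ≤ i → r i = f i (r (i + 1)) by
      obtain ⟨r, hr⟩ := h n le_rfl
      exact ⟨r, fun i hi => hr i hi (by omega)⟩
    intro k
    induction k with
    | zero => exact fun _ => ⟨fun _ => Classical.arbitrary _, fun i hi hi' => by omega⟩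
    | succ k ih =>
      intro hk
      obtain ⟨r, hr⟩ := ih (by omega)
      refine ⟨Function.update r (n - (k + 1)) (f _ (r (n - (k + 1) + 1))), fun i hi hi' => ?_⟩
      rw [Function.update_of_ne (by omega : i + 1 ≠ n - (k + 1))]
      rcases hi'.eq_or_lt with rfl | hlt
      · simp
      · rw [Function.update_of_ne hlt.ne', hr i hi (by omega)]
  obtain ⟨r, hr⟩ := IsCompact.nonempty_iInter_of_sequence_nonempty_isCompact_isClosed Z
    (fun n r hr i hi => hr i (hi.trans n.lt_succ_self)) hnonempty (hclosed 0).isCompact hclosed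
  exact ⟨r, fun n => Set.mem_iInter.mp hr (n + 1) n n.lt_succ_self⟩

/-! ### Continued fractions with prescribed digits -/

/-- The irrational numbers of the unit interval, on which the Gauss map acts. -/
def unitIrr : Set ℝ := {x | Irrational x ∧ 0 < x ∧ x < 1}

theorem inv_eq_digit_add_gaussMap {x : ℝ} (hx : 0 ≤ x) : x⁻¹ = digit x 0 + gaussMap x := by
  rw [gaussMap, digit, Function.iterate_zero_apply,
    natCast_floor_eq_intCast_floor (inv_nonneg.mpr hx), Int.floor_add_fract]

theorem gaussMap_iterate_mem {x : ℝ} (hx : x ∈ unitIrr) (n : ℕ) : gaussMap^[n] x ∈ unitIrr := by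
  suffices h : Set.MapsTo gaussMap unitIrr unitIrr from h.iterate n hx
  intro y hy
  have hirr : Irrational (gaussMap y) := by
    rw [gaussMap, Int.fract]
    exact hy.1.inv.sub_intCast _
  exact ⟨hirr, (Int.fract_nonneg _).lt_of_ne' hirr.ne_zero, Int.fract_lt_one _⟩

theorem one_le_digit {x : ℝ} (hx : x ∈ unitIrr) (n : ℕ) : 1 ≤ digit x n := by
  have hn := (gaussMap_iterate_mem hx n).2
  exact Nat.le_floor (by simpa using (one_lt_inv₀ hn.1).mpr hn.2 |>.le)

theorem irrational_of_iterate_gaussMap_ne_zero {x : ℝ}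
    (h : ∀ n, gaussMap^[n] (Int.fract x) ≠ 0) : Irrational x := by
  have hget : ∀ (n : ℕ) (v : ℝ), (∀ k, gaussMap^[k] (Int.fract v) ≠ 0) →
      (GenContFract.of v).s.get? n ≠ none := by
    intro n
    induction n with
    | zero =>
      intro v hv
      simp [show (GenContFract.of v).s.get? 0 = (GenContFract.of v).s.head from rfl,
        GenContFract.of_s_head (hv 0)]
    | succ n ih =>
      intro v hv
      rw [GenContFract.of_s_succ]
      exact ih _ fun k => hv (k + 1)
  rintro ⟨q, hq⟩
  obtain ⟨n, hn⟩ := (GenContFract.terminates_iff_rat x).mpr ⟨q, hq.symm⟩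
  exact hget n x h hn

theorem exists_digit_eq {a : ℕ → ℕ} (ha : ∀ n, 1 ≤ a n) : ∃ x ∈ unitIrr, ∀ n, digit x n = a n := by
  have ha' : ∀ n, (1 : ℝ) ≤ a n := fun n => by exact_mod_cast ha n
  have hpos : ∀ n (y : Set.Icc (0 : ℝ) 1), 0 < (a n : ℝ) + y := fun n y => by
    linarith [ha' n, y.2.1]
  obtain ⟨r, hr⟩ := exists_seq_eq_apply_succ (X := fun _ => Set.Icc (0 : ℝ) 1)
    (f := fun n y => ⟨((a n : ℝ) + y)⁻¹, inv_nonneg.mpr (hpos n y).le,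
      inv_le_one_of_one_le₀ (by linarith [ha' n, y.2.1])⟩)
    fun n => ((continuous_const.add continuous_subtype_val).inv₀
      fun y => (hpos n y).ne').subtype_mk _
  have hinv : ∀ n, (r n : ℝ)⁻¹ = a n + r (n + 1) := fun n => by
    rw [inv_eq_iff_eq_inv, congrArg Subtype.val (hr n)]
  have hr0 : ∀ n, 0 < (r n : ℝ) := fun n => inv_pos.mp (hinv n ▸ hpos n _)
  have hr1 : ∀ n, (r n : ℝ) < 1 := fun n =>
    (one_lt_inv₀ (hr0 n)).mp (by linarith [hinv n, ha' n, hr0 (n + 1)])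
  have hiter : ∀ n, gaussMap^[n] (r 0) = r n := fun n => by
    induction n with
    | zero => rfl
    | succ n ih =>
      rw [Function.iterate_succ_apply', ih, gaussMap, hinv, Int.fract_natCast_add,
        Int.fract_eq_self.mpr ⟨(hr0 _).le, hr1 _⟩]
  have hirr : Irrational (r 0 : ℝ) := irrational_of_iterate_gaussMap_ne_zero fun n => by
    rw [Int.fract_eq_self.mpr ⟨(hr0 0).le, hr1 0⟩, hiter]
    exact (hr0 n).ne'
  refine ⟨r 0, ⟨hirr, hr0 0, hr1 0⟩, fun n => ?_⟩
  rw [digit, hiter, hinv, Nat.floor_eq_iff (hpos n _).le]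
  exact ⟨by linarith [hr0 (n + 1)], by linarith [hr1 (n + 1)]⟩

theorem exists_digitVec_eq {a : ℕ → Fin d → ℕ} (ha : ∀ n, a n ∈ posVec d) :
    ∃ x ∈ irrCube d, ∀ n, digitVec x n = a n := by
  choose x hx hxa using fun j => exists_digit_eq (a := fun n => a n j) fun n => ha n j
  exact ⟨x, hx, fun n => funext fun j => hxa j n⟩

/-! ### Distances between continued fractions with a common initial block of digits -/

theorem iterate_gaussMap_le_inv_digit {x : ℝ} (hx : x ∈ unitIrr) (n : ℕ) :
    gaussMap^[n] x ≤ (digit x n : ℝ)⁻¹ := by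
  have hn := gaussMap_iterate_mem hx n
  rw [le_inv_comm₀ hn.2.1 (by exact_mod_cast one_le_digit hx n)]
  exact Nat.floor_le (inv_pos.mpr hn.2.1).le

theorem inv_digit_add_one_le_iterate_gaussMap {x : ℝ} (hx : x ∈ unitIrr) (n : ℕ) :
    ((digit x n : ℝ) + 1)⁻¹ ≤ gaussMap^[n] x :=
  inv_le_of_inv_le₀ (gaussMap_iterate_mem hx n).2.1 (Nat.lt_floor_add_one _).le

theorem abs_sub_eq_mul_abs_inv_sub_inv {x y : ℝ} (hx : 0 < x) (hy : 0 < y) :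
    |x - y| = x * y * |x⁻¹ - y⁻¹| := by
  rw [inv_sub_inv hx.ne' hy.ne', abs_div, abs_of_pos (mul_pos hx hy),
    mul_div_cancel₀ _ (mul_pos hx hy).ne', abs_sub_comm]

theorem abs_sub_eq_prod_mul_abs_sub {x y : ℝ} (hx : x ∈ unitIrr) (hy : y ∈ unitIrr) {n : ℕ}
    (h : ∀ i < n, digit x i = digit y i) :
    |x - y| = (∏ i ∈ Finset.range n, gaussMap^[i] x * gaussMap^[i] y) *
      |gaussMap^[n] x - gaussMap^[n] y| := by
  induction n with
  | zero => simp
  | succ n ih =>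
    have hxn := (gaussMap_iterate_mem hx n).2.1
    have hyn := (gaussMap_iterate_mem hy n).2.1
    have hdigit : digit (gaussMap^[n] x) 0 = digit (gaussMap^[n] y) 0 := h n n.lt_succ_self
    rw [ih fun i hi => h i (hi.trans n.lt_succ_self), abs_sub_eq_mul_abs_inv_sub_inv hxn hyn,
      inv_eq_digit_add_gaussMap hxn.le, inv_eq_digit_add_gaussMap hyn.le, hdigit,
      add_sub_add_left_eq_sub, Finset.prod_range_succ, Function.iterate_succ_apply',
      Function.iterate_succ_apply']
    ring

theorem abs_iterate_gaussMap_sub_le_one {x y : ℝ} (hx : x ∈ unitIrr) (hy : y ∈ unitIrr) (n : ℕ) :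
    |gaussMap^[n] x - gaussMap^[n] y| ≤ 1 := by
  have hxn := (gaussMap_iterate_mem hx n).2
  have hyn := (gaussMap_iterate_mem hy n).2
  exact abs_sub_le_iff.mpr ⟨by linarith, by linarith⟩

theorem abs_sub_le_prod_inv_sq {x y : ℝ} (hx : x ∈ unitIrr) (hy : y ∈ unitIrr) {b : ℕ → ℝ} {n : ℕ}
    (hb : ∀ i < n, 0 < b i) (hbx : ∀ i < n, b i ≤ digit x i)
    (h : ∀ i < n, digit x i = digit y i) :
    |x - y| ≤ ∏ i ∈ Finset.range n, (b i ^ 2)⁻¹ := by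
  have hxy : ∀ i, 0 < gaussMap^[i] x * gaussMap^[i] y := fun i =>
    mul_pos (gaussMap_iterate_mem hx i).2.1 (gaussMap_iterate_mem hy i).2.1
  have hfactor : ∀ i < n, ∀ z ∈ unitIrr, digit x i = digit z i → gaussMap^[i] z ≤ (b i)⁻¹ :=
    fun i hi z hz hxz => (iterate_gaussMap_le_inv_digit hz i).trans
      (inv_anti₀ (hb i hi) (hxz ▸ hbx i hi))
  rw [abs_sub_eq_prod_mul_abs_sub hx hy h]
  refine (mul_le_of_le_one_right (Finset.prod_nonneg fun i _ => (hxy i).le)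
    (abs_iterate_gaussMap_sub_le_one hx hy n)).trans
    (Finset.prod_le_prod (fun i _ => (hxy i).le) fun i hi => ?_)
  have hi := Finset.mem_range.mp hi
  rw [sq, mul_inv]
  exact mul_le_mul (hfactor i hi x hx rfl) (hfactor i hi y hy (h i hi))
    (gaussMap_iterate_mem hy i).2.1.le (inv_pos.mpr (hb i hi)).le

theorem prod_inv_sq_le_abs_sub {x y : ℝ} (hx : x ∈ unitIrr) (hy : y ∈ unitIrr) {B : ℕ → ℝ} {n : ℕ}
    (hBx : ∀ i ≤ n, (digit x i : ℝ) + 1 ≤ B i) (hBy : ∀ i ≤ n, (digit y i : ℝ) + 1 ≤ B i)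
    (h : ∀ i < n, digit x i = digit y i) (hn : 2 ≤ |(digit x n : ℝ) - digit y n|) :
    ∏ i ∈ Finset.range (n + 1), (B i ^ 2)⁻¹ ≤ |x - y| := by
  have hx' := fun i => (gaussMap_iterate_mem hx i).2
  have hy' := fun i => (gaussMap_iterate_mem hy i).2
  have hfactor : ∀ i ≤ n, (B i ^ 2)⁻¹ ≤ gaussMap^[i] x * gaussMap^[i] y := fun i hi => by
    have hdigit : ∀ z, 0 < (digit z i : ℝ) + 1 := fun z => by positivity
    rw [sq, mul_inv]
    exact mul_le_mul
      ((inv_anti₀ (hdigit x) (hBx i hi)).trans (inv_digit_add_one_le_iterate_gaussMap hx i))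
      ((inv_anti₀ (hdigit y) (hBy i hi)).trans (inv_digit_add_one_le_iterate_gaussMap hy i))
      (inv_pos.mpr ((hdigit x).trans_le (hBx i hi))).le (hx' i).1.le
  have hlast : (1 : ℝ) ≤ |(gaussMap^[n] x)⁻¹ - (gaussMap^[n] y)⁻¹| := by
    have hgauss : |gaussMap (gaussMap^[n] x) - gaussMap (gaussMap^[n] y)| ≤ 1 := by
      simpa only [Function.iterate_succ_apply'] using abs_iterate_gaussMap_sub_le_one hx hy (n + 1)
    rw [inv_eq_digit_add_gaussMap (hx' n).1.le, inv_eq_digit_add_gaussMap (hy' n).1.le,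
      add_sub_add_comm]
    have := abs_sub_abs_le_abs_add ((digit x n : ℝ) - digit y n)
      (gaussMap (gaussMap^[n] x) - gaussMap (gaussMap^[n] y))
    exact le_trans (by linarith) this
  calc ∏ i ∈ Finset.range (n + 1), (B i ^ 2)⁻¹
    _ ≤ ∏ i ∈ Finset.range (n + 1), gaussMap^[i] x * gaussMap^[i] y :=
      Finset.prod_le_prod (fun i _ => by positivity)
        fun i hi => hfactor i (Nat.lt_succ_iff.mp (Finset.mem_range.mp hi))
    _ ≤ (∏ i ∈ Finset.range (n + 1), gaussMap^[i] x * gaussMap^[i] y) *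
        |(gaussMap^[n] x)⁻¹ - (gaussMap^[n] y)⁻¹| := le_mul_of_one_le_right
          (Finset.prod_nonneg fun i _ => (mul_pos (hx' i).1 (hy' i).1).le) hlast
    _ = |x - y| := by
      rw [abs_sub_eq_prod_mul_abs_sub hx hy h,
        abs_sub_eq_mul_abs_inv_sub_inv (hx' n).1 (hy' n).1, Finset.prod_range_succ, mul_assoc]

/-! ### Coding and Hausdorff dimension -/

/-- The `n`-th remainder in the mixed radix expansion of `y` with radices `N 0, N 1, …`, that is
the fractional part of `N 0 * ⋯ * N (n - 1) * y` if `y ∈ [0, 1)`. -/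
def mixedRem (N : ℕ → ℕ) (y : ℝ) : ℕ → ℝ
  | 0 => y
  | n + 1 => Int.fract (N n * mixedRem N y n)

/-- The `n`-th digit in the mixed radix expansion of `y` with radices `N 0, N 1, …`. -/
def mixedDigit (N : ℕ → ℕ) (y : ℝ) (n : ℕ) : ℕ := ⌊N n * mixedRem N y n⌋₊

theorem mixedRem_mem_Ico (N : ℕ → ℕ) {y : ℝ} (hy : y ∈ Set.Ico 0 1) (n : ℕ) :
    mixedRem N y n ∈ Set.Ico 0 1 := by
  cases n with
  | zero => exact hy
  | succ n => exact ⟨Int.fract_nonneg _, Int.fract_lt_one _⟩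

theorem mixedDigit_lt {N : ℕ → ℕ} {n : ℕ} (hN : 0 < N n) {y : ℝ} (hy : y ∈ Set.Ico 0 1) :
    mixedDigit N y n < N n := by
  obtain ⟨h0, h1⟩ := mixedRem_mem_Ico N hy n
  have hN' : (0 : ℝ) < N n := by exact_mod_cast hN
  exact (Nat.floor_lt (by positivity)).mpr (mul_lt_of_lt_one_right hN' h1)

theorem mul_mixedRem (N : ℕ → ℕ) {y : ℝ} (hy : y ∈ Set.Ico 0 1) (n : ℕ) :
    N n * mixedRem N y n = mixedDigit N y n + mixedRem N y (n + 1) := by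
  have h0 := (mixedRem_mem_Ico N hy n).1
  rw [mixedDigit, natCast_floor_eq_intCast_floor (by positivity), mixedRem, Int.floor_add_fract]

theorem abs_sub_le_of_mixedDigit_eq {N : ℕ → ℕ} (hN : ∀ n, 0 < N n) {y z : ℝ}
    (hy : y ∈ Set.Ico 0 1) (hz : z ∈ Set.Ico 0 1) {n : ℕ}
    (h : ∀ i < n, mixedDigit N y i = mixedDigit N z i) :
    |y - z| ≤ (∏ i ∈ Finset.range n, (N i : ℝ))⁻¹ := by
  have hscaled : (∏ i ∈ Finset.range n, (N i : ℝ)) * (y - z) =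
      mixedRem N y n - mixedRem N z n := by
    induction n with
    | zero => simp [mixedRem]
    | succ n ih =>
      rw [Finset.prod_range_succ, mul_comm _ (N n : ℝ), mul_assoc,
        ih fun i hi => h i (hi.trans n.lt_succ_self), mul_sub, mul_mixedRem N hy,
        mul_mixedRem N hz, h n n.lt_succ_self, add_sub_add_left_eq_sub]
  have hpos : 0 < ∏ i ∈ Finset.range n, (N i : ℝ) :=
    Finset.prod_pos fun i _ => by exact_mod_cast hN i
  rw [← mul_one (_)⁻¹, le_inv_mul_iff₀ hpos, ← abs_of_pos hpos, ← abs_mul, hscaled]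
  exact (abs_sub_lt_of_nonneg_of_lt (mixedRem_mem_Ico N hy n).1 (mixedRem_mem_Ico N hy n).2
    (mixedRem_mem_Ico N hz n).1 (mixedRem_mem_Ico N hz n).2).le

section Coding

variable {A : ℕ → Type*} [∀ n, Fintype (A n)] {s C : NNReal}

theorem exists_coding_unitInterval [∀ n, Nonempty (A n)] :
    ∃ D : ℝ → ∀ n, A n, ∀ y ∈ Set.Ico (0 : ℝ) 1, ∀ z ∈ Set.Ico (0 : ℝ) 1, ∀ n,
      (∀ i < n, D y i = D z i) →
        |y - z| ≤ (∏ i ∈ Finset.range n, (Fintype.card (A i) : ℝ))⁻¹ := by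
  let N : ℕ → ℕ := fun n => Fintype.card (A n)
  have hN : ∀ n, 0 < N n := fun n => Fintype.card_pos
  refine ⟨fun y n => (Fintype.equivFin (A n)).symm ⟨mixedDigit N y n % N n, Nat.mod_lt _ (hN n)⟩,
    fun y hy z hz n h => abs_sub_le_of_mixedDigit_eq hN hy hz fun i hi => ?_⟩
  have hmod : mixedDigit N y i % N i = mixedDigit N z i % N i :=
    congrArg Fin.val ((Fintype.equivFin (A i)).symm.injective (h i hi))
  rwa [Nat.mod_eq_of_lt (mixedDigit_lt (hN i) hy), Nat.mod_eq_of_lt (mixedDigit_lt (hN i) hz)]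
    at hmod

theorem le_dimH_range_of_separated [∀ n, Nonempty (A n)] {X : Type*} [MetricSpace X]
    {g : (∀ n, A n) → X} {ρ : ℕ → ℝ} (hρ : ∀ n, 0 ≤ ρ n) (hρ0 : Tendsto ρ atTop (𝓝 0))
    (hg : ∀ a b, a ≠ b → ρ (PiNat.firstDiff a b) ≤ dist (g a) (g b))
    (hC : ∀ n, (∏ i ∈ Finset.range n, (Fintype.card (A i) : ℝ))⁻¹ ≤ C * ρ n ^ (s : ℝ)) :
    s ≤ dimH (Set.range g) := by
  rcases eq_zero_or_pos s with rfl | hs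
  · simp
  obtain ⟨D, hD⟩ := exists_coding_unitInterval (A := A)
  have hclose : ∀ y ∈ Set.Ico (0 : ℝ) 1, ∀ z ∈ Set.Ico (0 : ℝ) 1, ∀ n,
      (∀ i < n, D y i = D z i) → dist y z ≤ C * ρ n ^ (s : ℝ) :=
    fun y hy z hz n h => (hD y hy z hz n h).trans (hC n)
  have hholder : ∀ y ∈ Set.Ico (0 : ℝ) 1, ∀ z ∈ Set.Ico (0 : ℝ) 1,
      edist y z ≤ C * edist (g (D y)) (g (D z)) ^ (s : ℝ) := by
    intro y hy z hz
    by_cases hyz : D y = D z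
    · have hlim : Tendsto (fun n => C * ρ n ^ (s : ℝ)) atTop (𝓝 0) := by
        simpa [hs.ne'] using (hρ0.rpow_const (.inr s.coe_nonneg)).const_mul (C : ℝ)
      have hdist : dist y z ≤ 0 := ge_of_tendsto' hlim fun n =>
        hclose y hy z hz n fun i _ => congrFun hyz i
      simp [dist_le_zero.mp hdist]
    · have hdist : dist y z ≤ C * dist (g (D y)) (g (D z)) ^ (s : ℝ) :=
        (hclose y hy z hz _ fun i => PiNat.apply_eq_of_lt_firstDiff).trans
          (by gcongr; exacts [hρ _, hg _ _ hyz])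
      rw [edist_dist, edist_dist, ENNReal.ofReal_rpow_of_nonneg dist_nonneg s.coe_nonneg,
        ← ENNReal.ofReal_coe_nnreal, ← ENNReal.ofReal_mul C.coe_nonneg]
      exact ENNReal.ofReal_le_ofReal hdist
  calc (s : ENNReal) = s * dimH (Set.Ico (0 : ℝ) 1) := by
        rw [Real.dimH_of_nonempty_interior (by simp), Module.finrank_self, Nat.cast_one, mul_one]
    _ ≤ dimH ((g ∘ D) '' Set.Ico 0 1) := mul_dimH_le_dimH_image hs hholder
    _ ≤ dimH (Set.range g) := dimH_mono (by rintro _ ⟨y, -, rfl⟩; exact ⟨D y, rfl⟩)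

theorem dimH_le_of_coding {X : Type*} [MetricSpace X] {F : Set X} {r : ℕ → ℝ} (hr : ∀ n, 0 ≤ r n)
    (hr0 : Tendsto r atTop (𝓝 0)) (D : F → ∀ n, A n)
    (hD : ∀ x y n, (∀ i < n, D x i = D y i) → dist x y ≤ r n)
    (hC : ∀ n, (∏ i ∈ Finset.range n, (Fintype.card (A i) : ℝ)) * r n ^ (s : ℝ) ≤ C) :
    dimH F ≤ s := by
  borelize X
  apply dimH_le_of_hausdorffMeasure_ne_top
  let piece : ∀ n : ℕ, (∀ i : Fin n, A i) → Set X := fun n p =>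
    Subtype.val '' {x : F | ∀ i : Fin n, D x i = p i}
  have hdiam : ∀ n p, Metric.ediam (piece n p) ≤ ENNReal.ofReal (r n) := by
    refine fun n p => Metric.ediam_le ?_
    rintro _ ⟨x, hx, rfl⟩ _ ⟨y, hy, rfl⟩
    rw [edist_dist]
    exact ENNReal.ofReal_le_ofReal
      (hD x y n fun i hi => (hx ⟨i, hi⟩).trans (hy ⟨i, hi⟩).symm)
  have hcover : ∀ n, F ⊆ ⋃ p, piece n p := fun n x hx =>
    Set.mem_iUnion.mpr ⟨fun i => D ⟨x, hx⟩ i, ⟨x, hx⟩, fun _ => rfl, rfl⟩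
  have hsum : ∀ n, ∑ p, Metric.ediam (piece n p) ^ (s : ℝ) ≤ C := fun n => calc
    ∑ p, Metric.ediam (piece n p) ^ (s : ℝ)
      ≤ ∑ _ : (∀ i : Fin n, A i), ENNReal.ofReal (r n) ^ (s : ℝ) := by
        gcongr; exact hdiam n _
    _ = ENNReal.ofReal
          ((∏ i ∈ Finset.range n, (Fintype.card (A i) : ℝ)) * r n ^ (s : ℝ)) := by
        rw [Finset.sum_const, Finset.card_univ, Fintype.card_pi, nsmul_eq_mul,
          ENNReal.ofReal_mul (Finset.prod_nonneg fun i _ => by positivity),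
          ENNReal.ofReal_rpow_of_nonneg (hr n) s.coe_nonneg,
          Finset.prod_range (fun i => (Fintype.card (A i) : ℝ)), ← Nat.cast_prod,
          ENNReal.ofReal_natCast]
    _ ≤ C := by
        rw [← ENNReal.ofReal_coe_nnreal]
        exact ENNReal.ofReal_le_ofReal (hC n)
  refine ne_top_of_le_ne_top (ENNReal.coe_ne_top (r := C)) <|
    (MeasureTheory.Measure.hausdorffMeasure_le_liminf_sum (s : ℝ) F (l := atTop)
      (fun n => ENNReal.ofReal (r n)) (by simpa using ENNReal.tendsto_ofReal hr0) piece
      (Eventually.of_forall hdiam) (Eventually.of_forall hcover)).trans ?_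
  exact (liminf_le_liminf (v := fun _ : ℕ => (C : ENNReal)) (Eventually.of_forall hsum)).trans
    (liminf_const _).le

end Coding

/-! ### The dimension of sets of points with restricted digit vectors -/

theorem exists_inv_prod_range_le {N B : ℕ → ℝ} {s : ℝ} (hN : ∀ n, 0 < N n) (hB : ∀ n, 0 < B n)
    (h : ∀ᶠ n in atTop, B (n + 1) ^ (2 * s) ≤ N n) :
    ∃ C : NNReal, ∀ n, (∏ i ∈ Finset.range n, N i)⁻¹ ≤
      C * (∏ i ∈ Finset.range (n + 1), (B i ^ 2)⁻¹) ^ s := by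
  have hpow : ∀ i, 0 < B i ^ (2 * s) := fun i => Real.rpow_pos_of_pos (hB i) _
  obtain ⟨C, hC⟩ := exists_prod_range_le_mul_prod_range (fun i => (hpow (i + 1)).le) hN h
  refine ⟨C * (B 0 ^ (2 * s)).toNNReal, fun n => ?_⟩
  have hprod : 0 < ∏ i ∈ Finset.range n, B (i + 1) ^ (2 * s) := Finset.prod_pos fun i _ => hpow _
  rw [prod_inv_sq_rpow _ fun i => (hB i).le, Finset.prod_range_succ', NNReal.coe_mul,
    Real.coe_toNNReal _ (hpow 0).le, mul_inv, mul_comm (∏ i ∈ _, _)⁻¹, mul_assoc,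
    mul_inv_cancel_left₀ (hpow 0).ne', ← div_eq_mul_inv, le_div_iff₀ hprod,
    inv_mul_le_iff₀ (Finset.prod_pos fun i _ => hN i), mul_comm _ (C : ℝ)]
  exact hC n

theorem dist_le_prod_inv_sq {x y : Fin d → ℝ} (hx : x ∈ irrCube d) (hy : y ∈ irrCube d)
    {b : ℕ → ℝ} {n : ℕ} (hb : ∀ i, 0 < b i) (hbx : ∀ i < n, ∀ j, b i ≤ digitVec x i j)
    (h : ∀ i < n, digitVec x i = digitVec y i) :
    dist x y ≤ ∏ i ∈ Finset.range n, (b i ^ 2)⁻¹ :=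
  (dist_pi_le_iff (Finset.prod_nonneg fun i _ => by positivity)).mpr fun j =>
    abs_sub_le_prod_inv_sq (hx j) (hy j) (fun i _ => hb i) (fun i hi => hbx i hi j)
      fun i hi => congrFun (h i hi) j

theorem prod_inv_sq_le_dist {x y : Fin d → ℝ} (hx : x ∈ irrCube d) (hy : y ∈ irrCube d)
    {B : ℕ → ℝ} {n : ℕ} (hBx : ∀ i j, (digitVec x i j : ℝ) + 1 ≤ B i)
    (hBy : ∀ i j, (digitVec y i j : ℝ) + 1 ≤ B i)
    (h : ∀ i < n, digitVec x i = digitVec y i) (hn : 2 ≤ dist (digitVec x n) (digitVec y n)) :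
    ∏ i ∈ Finset.range (n + 1), (B i ^ 2)⁻¹ ≤ dist x y := by
  obtain ⟨j, hj⟩ : ∃ j, 2 ≤ dist (digitVec x n j) (digitVec y n j) := by
    by_contra! hlt
    exact hn.not_gt ((dist_pi_lt_iff two_pos).mpr hlt)
  exact (prod_inv_sq_le_abs_sub (hx j) (hy j) (fun i _ => hBx i j) (fun i _ => hBy i j)
    (fun i hi => congrFun (h i hi) j) hj).trans (dist_le_pi_dist x y j)

theorem finite_of_forall_le {A : Set (Fin d → ℕ)} {B : ℝ} (h : ∀ v ∈ A, ∀ j, (v j : ℝ) ≤ B) :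
    A.Finite :=
  (Set.finite_Iic fun _ => ⌊B⌋₊).subset fun v hv j => Nat.le_floor (h v hv j)

/-- The points of the irrational cube whose `n`-th digit vector lies in `A n`, for all `n`. -/
def digitSet (A : ℕ → Set (Fin d → ℕ)) : Set (Fin d → ℝ) :=
  {x ∈ irrCube d | ∀ n, digitVec x n ∈ A n}

section DigitSet

variable {A : ℕ → Set (Fin d → ℕ)} {s : NNReal}

theorem digitSet_nonempty (hpos : ∀ n, A n ⊆ posVec d) (hne : ∀ n, (A n).Nonempty) :
    (digitSet A).Nonempty := by
  choose a ha using hne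
  obtain ⟨x, hx, hxa⟩ := exists_digitVec_eq fun n => hpos n (ha n)
  exact ⟨x, hx, fun n => hxa n ▸ ha n⟩

theorem dimH_digitSet_le (hfin : ∀ n, (A n).Finite) {b : ℕ → ℝ} (hb : ∀ n, 0 < b n)
    (hbA : ∀ n, ∀ v ∈ A n, ∀ j, b n ≤ v j) (hb_top : Tendsto b atTop atTop)
    (hcard : ∀ᶠ n in atTop, ((A n).ncard : ℝ) ≤ b n ^ (2 * (s : ℝ))) :
    dimH (digitSet A) ≤ s := by
  have := fun n => (hfin n).fintype
  have hr : Tendsto (fun n => ∏ i ∈ Finset.range n, (b i ^ 2)⁻¹) atTop (𝓝 0) :=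
    tendsto_prod_range_zero_of_tendsto_zero (fun i => (inv_pos.mpr (pow_pos (hb i) 2)).ne')
      ((tendsto_pow_atTop two_ne_zero).comp hb_top).inv_tendsto_atTop
  have hpow : ∀ i, 0 < b i ^ (2 * (s : ℝ)) := fun i => Real.rpow_pos_of_pos (hb i) _
  obtain ⟨C, hC⟩ := exists_prod_range_le_mul_prod_range (fun _ => Nat.cast_nonneg _) hpow hcard
  refine dimH_le_of_coding (A := fun n => A n) (C := C)
    (fun n => Finset.prod_nonneg fun i _ => by positivity) hr
    (fun x n => ⟨digitVec x n, x.2.2 n⟩) (fun x y n h => ?_) fun n => ?_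
  · exact dist_le_prod_inv_sq x.2.1 y.2.1 hb (fun i _ => hbA i _ (x.2.2 i))
      fun i hi => congrArg Subtype.val (h i hi)
  · rw [prod_inv_sq_rpow _ fun i => (hb i).le, ← div_eq_mul_inv,
      div_le_iff₀ (Finset.prod_pos fun i _ => hpow i)]
    simpa only [← Nat.card_eq_fintype_card, Nat.card_coe_set_eq] using hC n

theorem le_dimH_digitSet (hpos : ∀ n, A n ⊆ posVec d) (hne : ∀ n, (A n).Nonempty)
    (hsep : ∀ n, TwoSeparated (A n)) {B : ℕ → ℝ} (hB : ∀ n, 0 < B n)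
    (hAB : ∀ n, ∀ v ∈ A n, ∀ j, (v j : ℝ) + 1 ≤ B n) (hB_top : Tendsto B atTop atTop)
    (hcard : ∀ᶠ n in atTop, B (n + 1) ^ (2 * (s : ℝ)) ≤ (A n).ncard) :
    s ≤ dimH (digitSet A) := by
  have hfin : ∀ n, (A n).Finite := fun n =>
    finite_of_forall_le fun v hv j => (le_add_of_nonneg_right zero_le_one).trans (hAB n v hv j)
  have := fun n => (hfin n).fintype
  have := fun n => (hne n).to_subtype
  choose g hg hga using fun a : ∀ n, A n => exists_digitVec_eq fun n => hpos n (a n).2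
  have hρ : Tendsto (fun n => ∏ i ∈ Finset.range (n + 1), (B i ^ 2)⁻¹) atTop (𝓝 0) :=
    (tendsto_prod_range_zero_of_tendsto_zero (fun i => (inv_pos.mpr (pow_pos (hB i) 2)).ne')
      ((tendsto_pow_atTop two_ne_zero).comp hB_top).inv_tendsto_atTop).comp
      (tendsto_add_atTop_nat 1)
  obtain ⟨C, hC⟩ := exists_inv_prod_range_le
    (fun n => Nat.cast_pos.mpr ((Set.ncard_pos (hfin n)).mpr (hne n))) hB hcard
  refine (le_dimH_range_of_separated (A := fun n => A n) (g := g) (C := C)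
    (fun n => Finset.prod_nonneg fun i _ => by positivity) hρ (fun a b hab => ?_)
    fun n => ?_).trans (dimH_mono (Set.range_subset_iff.mpr fun a => ⟨hg a, fun n => ?_⟩))
  · have hn := PiNat.apply_firstDiff_ne hab
    refine prod_inv_sq_le_dist (hg a) (hg b) (fun i => hga a i ▸ hAB i _ (a i).2)
      (fun i => hga b i ▸ hAB i _ (b i).2) (fun i hi => ?_) ?_
    · rw [hga, hga, PiNat.apply_eq_of_lt_firstDiff hi]
    · rw [hga, hga]
      exact hsep _ (a _).2 (b _).2 (Subtype.coe_injective.ne hn)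
  · simpa only [← Nat.card_eq_fintype_card, Nat.card_coe_set_eq] using hC n
  · exact hga a n ▸ (a n).2

end DigitSet

/-! ### Asymptotics of `x ^ δ / (log x) ^ β` -/

theorem isLittleO_rpow_rpow_div_log_rpow {e δ : ℝ} (h : e < δ) (β : ℝ) :
    (fun x : ℝ => x ^ e) =o[atTop] fun x => x ^ δ / Real.log x ^ β := by
  have hlog := (isLittleO_log_rpow_rpow_atTop β (sub_pos.mpr h)).inv_rev (by
    filter_upwards [eventually_gt_atTop 1] with x hx h0
    exact absurd h0 (Real.rpow_pos_of_pos (Real.log_pos hx) β).ne')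
  refine ((Asymptotics.isBigO_refl (fun x : ℝ => x ^ δ) atTop).mul_isLittleO hlog).congr' ?_
    EventuallyEq.rfl
  filter_upwards [eventually_gt_atTop 0] with x hx
  rw [← Real.rpow_neg hx.le, ← Real.rpow_add hx, neg_sub, add_sub_cancel]

theorem isLittleO_rpow_rpow_of_lt {e δ : ℝ} (h : e < δ) :
    (fun x : ℝ => x ^ e) =o[atTop] fun x => x ^ δ := by
  simpa only [Real.rpow_zero, div_one] using isLittleO_rpow_rpow_div_log_rpow h 0

theorem isLittleO_rpow_div_log_rpow_rpow {e δ : ℝ} (h : δ < e) (β : ℝ) :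
    (fun x : ℝ => x ^ δ / Real.log x ^ β) =o[atTop] fun x => x ^ e := by
  refine ((Asymptotics.isBigO_refl (fun x : ℝ => x ^ δ) atTop).mul_isLittleO
    (isLittleO_log_rpow_rpow_atTop (-β) (sub_pos.mpr h))).congr' ?_ ?_
  · filter_upwards [eventually_gt_atTop 1] with x hx
    rw [Real.rpow_neg (Real.log_pos hx).le, div_eq_mul_inv]
  · filter_upwards [eventually_gt_atTop 0] with x hx
    rw [← Real.rpow_add hx, add_sub_cancel]

theorem eventually_rpow_div_log_rpow_pos (δ β : ℝ) :
    ∀ᶠ x : ℝ in atTop, 0 < x ^ δ / Real.log x ^ β := by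
  filter_upwards [eventually_gt_atTop 1] with x hx
  have hlog := Real.log_pos hx
  positivity

theorem tendsto_log_const_mul_div_log {b : ℝ} (hb : 0 < b) :
    Tendsto (fun x => Real.log (b * x) / Real.log x) atTop (𝓝 1) := by
  have hlim : Tendsto (fun x => Real.log b / Real.log x + 1) atTop (𝓝 1) := by
    simpa using (Real.tendsto_log_atTop.const_div_atTop (Real.log b)).add_const 1
  refine hlim.congr' ?_
  filter_upwards [eventually_gt_atTop 1] with x hx
  rw [Real.log_mul hb.ne' (by positivity), div_add_one (Real.log_pos hx).ne']

theorem tendsto_rpow_div_log_rpow_div_const_mul {b : ℝ} (hb : 0 < b) (δ β : ℝ) :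
    Tendsto (fun x : ℝ => x ^ δ / Real.log x ^ β / ((b * x) ^ δ / Real.log (b * x) ^ β)) atTop
      (𝓝 (b ^ δ)⁻¹) := by
  have hlim : Tendsto (fun x => (b ^ δ)⁻¹ * (Real.log (b * x) / Real.log x) ^ β) atTop
      (𝓝 (b ^ δ)⁻¹) := by
    simpa using ((tendsto_log_const_mul_div_log hb).rpow_const (p := β)
      (.inl one_ne_zero)).const_mul (b ^ δ)⁻¹
  refine hlim.congr' ?_
  filter_upwards [eventually_gt_atTop 1, (tendsto_id.const_mul_atTop hb).eventually_gt_atTop 1]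
    with x hx hbx
  have hlog := Real.log_pos hx
  have hlog' := Real.log_pos (show 1 < b * x from hbx)
  have hxδ : x ^ δ ≠ 0 := (Real.rpow_pos_of_pos (by linarith) δ).ne'
  rw [Real.div_rpow hlog'.le hlog.le, Real.mul_rpow hb.le (by linarith)]
  field_simp

/-! ### Counting lattice vectors by their norm -/

theorem le_supNorm (v : Fin d → ℕ) (j : Fin d) : v j ≤ supNorm v :=
  Finset.le_sup (f := v) (Finset.mem_univ j)

theorem exists_eq_supNorm [NeZero d] (v : Fin d → ℕ) : ∃ j, v j = supNorm v := by
  obtain ⟨j, -, hj⟩ := Finset.exists_mem_eq_sup Finset.univ Finset.univ_nonempty v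
  exact ⟨j, hj.symm⟩

theorem two_le_dist_of_supNorm_add_two_le [NeZero d] {v w : Fin d → ℕ}
    (h : supNorm v + 2 ≤ supNorm w) : 2 ≤ dist v w := by
  obtain ⟨j, hj⟩ := exists_eq_supNorm w
  have hvw : v j + 2 ≤ w j := by have := le_supNorm v j; omega
  calc (2 : ℝ) ≤ (w j : ℝ) - v j := by rw [le_sub_iff_add_le']; exact_mod_cast hvw
    _ ≤ dist (v j) (w j) := by rw [dist_comm]; exact le_abs_self _
    _ ≤ dist v w := dist_le_pi_dist v w j

/-- The elements of `S` whose sup norm lies in the set `I` of real numbers. -/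
def shell (S : Set (Fin d → ℕ)) (I : Set ℝ) : Set (Fin d → ℕ) := {v ∈ S | (supNorm v : ℝ) ∈ I}

/-- The number `|S ∩ Q_N|` of elements of `S` in the box of side `N`. -/
def boxCount (S : Set (Fin d → ℕ)) (N : ℕ) : ℕ := (S ∩ box d N).ncard

section Counting

variable {S T : Set (Fin d → ℕ)} {I : Set ℝ}

theorem shell_finite (S : Set (Fin d → ℕ)) (hI : BddAbove I) : (shell S I).Finite :=
  have ⟨_, hB⟩ := hI
  finite_of_forall_le fun v hv j => (Nat.cast_le.mpr (le_supNorm v j)).trans (hB hv.2)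

theorem inter_box_eq_shell (hS : S ⊆ posVec d) (N : ℕ) : S ∩ box d N = shell S (Set.Iic (N : ℝ)) :=
  Set.ext fun v => and_congr_right fun hv => by
    rw [Set.mem_Iic, Nat.cast_le, supNorm, Finset.sup_le_iff]
    exact ⟨fun h j _ => (h j).2, fun h j => ⟨hS hv j, h j (Finset.mem_univ j)⟩⟩

theorem boxCount_eq_ncard_shell (hS : S ⊆ posVec d) (N : ℕ) :
    boxCount S N = (shell S (Set.Iic (N : ℝ))).ncard := by
  rw [boxCount, inter_box_eq_shell hS]

theorem box_finite (d N : ℕ) : (box d N).Finite :=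
  finite_of_forall_le fun _ hv j => Nat.cast_le.mpr (hv j).2

theorem boxCount_mono (S : Set (Fin d → ℕ)) : Monotone (boxCount S) := fun _ _ h =>
  Set.ncard_le_ncard (Set.inter_subset_inter_right _ fun _ hv j =>
    ⟨(hv j).1, (hv j).2.trans h⟩) ((box_finite d _).inter_of_right _)

theorem boxCount_add_ncard_shell_Ioc (hS : S ⊆ posVec d) {m n : ℕ} (hmn : m ≤ n) :
    boxCount S m + (shell S (Set.Ioc (m : ℝ) n)).ncard = boxCount S n := by
  rw [boxCount_eq_ncard_shell hS, boxCount_eq_ncard_shell hS,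
    ← Set.ncard_union_eq _ (shell_finite S bddAbove_Iic) (shell_finite S bddAbove_Ioc)]
  · rw [← Set.Iic_union_Ioc_eq_Iic (Nat.cast_le.mpr hmn)]
    congr 1
    ext v
    exact (and_or_left (a := v ∈ S)).symm
  · exact Set.disjoint_left.mpr fun v hv hv' => hv'.2.1.not_ge hv.2

theorem relUpperDensity_eq_zero_of_isLittleO
    (h : (fun N => (boxCount T N : ℝ)) =o[atTop] fun N => (boxCount S N : ℝ)) :
    relUpperDensity T S = 0 :=
  h.tendsto_div_nhds_zero.limsup_eq

end Counting

namespace HasPolyDensity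

variable {S : Set (Fin d → ℕ)} {α : ℝ}

theorem exists_isTheta (hS : HasPolyDensity S α) :
    ∃ β : ℝ, (fun N => (boxCount S N : ℝ)) =Θ[atTop]
      fun N : ℕ => (N : ℝ) ^ (d / α) / Real.log N ^ β := by
  obtain ⟨β, c, C, hc, -, h⟩ := hS
  have hpos := tendsto_natCast_atTop_atTop.eventually (eventually_rpow_div_log_rpow_pos (d / α) β)
  refine ⟨β, .of_bound C ?_, .of_bound c⁻¹ ?_⟩ <;> filter_upwards [h, hpos] with N hN hN0
  · rw [Real.norm_natCast, Real.norm_of_nonneg hN0.le]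
    exact hN.2
  · rw [Real.norm_natCast, Real.norm_of_nonneg hN0.le, le_inv_mul_iff₀ hc]
    exact hN.1

theorem rpow_isLittleO_boxCount (hS : HasPolyDensity S α) {e : ℝ} (he : e < d / α) :
    (fun N : ℕ => (N : ℝ) ^ e) =o[atTop] fun N => (boxCount S N : ℝ) := by
  obtain ⟨β, hβ⟩ := hS.exists_isTheta
  exact ((isLittleO_rpow_rpow_div_log_rpow he β).comp_tendsto
    tendsto_natCast_atTop_atTop).trans_isTheta hβ.symm

theorem boxCount_isLittleO_rpow (hS : HasPolyDensity S α) {e : ℝ} (he : d / α < e) :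
    (fun N => (boxCount S N : ℝ)) =o[atTop] fun N : ℕ => (N : ℝ) ^ e := by
  obtain ⟨β, hβ⟩ := hS.exists_isTheta
  exact hβ.trans_isLittleO ((isLittleO_rpow_div_log_rpow_rpow he β).comp_tendsto
    tendsto_natCast_atTop_atTop)

theorem boxCount_mul_isBigO (hS : HasPolyDensity S α) {b : ℕ} (hb : 0 < b) :
    (fun N => (boxCount S (b * N) : ℝ)) =O[atTop] fun N => (boxCount S N : ℝ) := by
  obtain ⟨β, hβ⟩ := hS.exists_isTheta
  have hb' : (0 : ℝ) < b := Nat.cast_pos.mpr hb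
  have hscale := (Asymptotics.isBigO_of_div_tendsto_nhds_of_ne_zero
    (tendsto_rpow_div_log_rpow_div_const_mul hb' (d / α) β)
    (inv_pos.mpr (Real.rpow_pos_of_pos hb' _)).ne').comp_tendsto tendsto_natCast_atTop_atTop
  have hcomp := hβ.1.comp_tendsto (tendsto_id.const_mul_atTop' hb)
  refine (hcomp.congr_right fun N => ?_).trans (hscale.trans hβ.2)
  simp

theorem exists_two_mul_boxCount_le (hS : HasPolyDensity S α) (hδ : 0 < d / α) :
    ∃ b : ℕ, 2 ≤ b ∧ ∀ᶠ N in atTop, 2 * boxCount S N ≤ boxCount S (b * N) := by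
  obtain ⟨β, c, C, hc, hC, h⟩ := hS
  have hlim : Tendsto (fun b : ℕ => ((b : ℝ) ^ (d / α))⁻¹) atTop (𝓝 0) :=
    ((tendsto_rpow_atTop hδ).comp tendsto_natCast_atTop_atTop).inv_tendsto_atTop
  obtain ⟨b, hb, hb2⟩ := ((hlim.eventually_lt_const (show 0 < c / (2 * C) by positivity)).and
    (eventually_ge_atTop 2)).exists
  have hb0 : 0 < b := by omega
  refine ⟨b, hb2, ?_⟩
  have htop : Tendsto (fun N : ℕ => (b : ℝ) * N) atTop atTop :=
    tendsto_natCast_atTop_atTop.const_mul_atTop (Nat.cast_pos.mpr hb0)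
  filter_upwards [h, (tendsto_id.const_mul_atTop' hb0).eventually h,
    htop.eventually (eventually_rpow_div_log_rpow_pos (d / α) β),
    ((tendsto_rpow_div_log_rpow_div_const_mul (Nat.cast_pos.mpr hb0) (d / α) β).comp
      tendsto_natCast_atTop_atTop).eventually_lt_const hb] with N hN hbN hpos hratio
  have hscale := (div_lt_iff₀ hpos).mp hratio
  rw [id_eq, Nat.cast_mul] at hbN
  have hle : 2 * (boxCount S N : ℝ) ≤ boxCount S (b * N) := calc
    2 * (boxCount S N : ℝ) ≤ 2 * (C * ((N : ℝ) ^ (d / α) / Real.log N ^ β)) := by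
      gcongr; exact hN.2
    _ ≤ 2 * (C * (c / (2 * C) * ((b * N : ℝ) ^ (d / α) / Real.log (b * N) ^ β))) := by
      gcongr
    _ = c * ((b * N : ℝ) ^ (d / α) / Real.log (b * N) ^ β) := by field_simp
    _ ≤ boxCount S (b * N) := hbN.1
  exact_mod_cast hle

end HasPolyDensity

/-! ### Thinning a set of polynomial density -/

theorem exists_twoSeparated_subset_card_le (U : Finset (Fin d → ℕ)) :
    ∃ T ⊆ U, TwoSeparated (T : Set (Fin d → ℕ)) ∧ U.card ≤ 2 ^ d * T.card := by
  let parity : (Fin d → ℕ) → Fin d → Bool := fun v j => (v j).bodd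
  obtain ⟨p, -, hp⟩ := Finset.exists_le_card_fiber_of_nsmul_le_card_of_maps_to
    (s := U) (t := Finset.univ) (f := parity) (b := (U.card : ℝ) / 2 ^ d)
    (fun _ _ => Finset.mem_univ _) Finset.univ_nonempty
    (by simp [mul_div_cancel₀])
  refine ⟨U.filter fun v => parity v = p, Finset.filter_subset _ _, fun v hv w hw hvw => ?_, ?_⟩
  · obtain ⟨j, hj⟩ := Function.ne_iff.mp hvw
    have hparity : (v j).bodd = (w j).bodd :=
      congrFun ((Finset.mem_filter.mp hv).2.trans (Finset.mem_filter.mp hw).2.symm) j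
    have hdist : 2 ≤ |(v j : ℤ) - w j| := by
      have := Nat.mod_two_of_bodd (v j)
      have := Nat.mod_two_of_bodd (w j)
      grind
    refine le_trans ?_ (dist_le_pi_dist v w j)
    rw [Nat.dist_eq]
    exact_mod_cast hdist
  · rw [div_le_iff₀' (by positivity)] at hp
    exact_mod_cast hp

theorem exists_twoSeparated_subset_card_eq (U : Finset (Fin d → ℕ)) {m : ℕ} (hm : m ≠ 0) :
    ∃ T ⊆ U, TwoSeparated (T : Set (Fin d → ℕ)) ∧ T.card = ⌈(U.card : ℝ) / (2 ^ d * m)⌉₊ := by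
  obtain ⟨V, hVU, hV, hcard⟩ := exists_twoSeparated_subset_card_le U
  have hle : ⌈(U.card : ℝ) / (2 ^ d * m)⌉₊ ≤ V.card := by
    rw [Nat.ceil_le, div_le_iff₀' (by positivity)]
    have hcard' : (U.card : ℝ) ≤ 2 ^ d * V.card := by exact_mod_cast hcard
    have hm' : (1 : ℝ) ≤ m := by exact_mod_cast Nat.one_le_iff_ne_zero.mpr hm
    calc (U.card : ℝ) ≤ 2 ^ d * 1 * V.card := by rwa [mul_one]
      _ ≤ 2 ^ d * m * V.card := by gcongr
  obtain ⟨T, hTV, hT⟩ := Finset.exists_subset_card_eq hle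
  exact ⟨T, hTV.trans hVU, Set.Pairwise.mono (Finset.coe_subset.mpr hTV) hV, hT⟩

/-- The elements of `S` with sup norm in `(b ^ (2 * k), b ^ (2 * k + 1)]`. Leaving out the norms in
`(b ^ (2 * k + 1), b ^ (2 * k + 2)]` keeps different annuli apart. -/
def annulus (S : Set (Fin d → ℕ)) (b k : ℕ) : Set (Fin d → ℕ) :=
  shell S (Set.Ioc (((b ^ 2) ^ k : ℕ) : ℝ) ((b * (b ^ 2) ^ k : ℕ) : ℝ))

section Annulus

variable {S : Set (Fin d → ℕ)} {b : ℕ} {T : ℕ → Set (Fin d → ℕ)}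

theorem annulus_finite (S : Set (Fin d → ℕ)) (b k : ℕ) : (annulus S b k).Finite :=
  shell_finite S bddAbove_Ioc

theorem mem_annulus_iff {k : ℕ} {v : Fin d → ℕ} :
    v ∈ annulus S b k ↔ v ∈ S ∧ (b ^ 2) ^ k < supNorm v ∧ supNorm v ≤ b * (b ^ 2) ^ k := by
  simp only [annulus, shell, Set.mem_Ioc, Nat.cast_lt, Nat.cast_le, Set.mem_ofPred_eq]

theorem boxCount_add_ncard_annulus (hS : S ⊆ posVec d) (hb : 0 < b) (k : ℕ) :
    boxCount S ((b ^ 2) ^ k) + (annulus S b k).ncard = boxCount S (b * (b ^ 2) ^ k) :=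
  boxCount_add_ncard_shell_Ioc hS (Nat.le_mul_of_pos_left _ hb)

theorem sum_ncard_annulus_le (hS : S ⊆ posVec d) (hb : 0 < b) (k : ℕ) :
    ∑ i ∈ Finset.range (k + 1), (annulus S b i).ncard ≤ boxCount S (b * (b ^ 2) ^ k) := by
  induction k with
  | zero => simpa using Nat.le.intro ((add_comm _ _).trans (boxCount_add_ncard_annulus hS hb 0))
  | succ k ih =>
    have hgap : boxCount S (b * (b ^ 2) ^ k) ≤ boxCount S ((b ^ 2) ^ (k + 1)) := by
      refine boxCount_mono S ?_
      rw [pow_succ' (b ^ 2)]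
      exact Nat.mul_le_mul_right _ (Nat.le_self_pow two_ne_zero b)
    rw [Finset.sum_range_succ, ← boxCount_add_ncard_annulus hS hb]
    exact Nat.add_le_add_right (ih.trans hgap) _

theorem twoSeparated_iUnion [NeZero d] (hb : 2 ≤ b) (hT : ∀ k, T k ⊆ annulus S b k)
    (hsep : ∀ k, TwoSeparated (T k)) : TwoSeparated (⋃ k, T k) := by
  have hlt : ∀ {i j}, i < j → ∀ {v w}, v ∈ T i → w ∈ T j → 2 ≤ dist v w := by
    intro i j hij v w hv hw
    refine two_le_dist_of_supNorm_add_two_le ?_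
    have hvi := (mem_annulus_iff.mp (hT i hv)).2.2
    have hwj := (mem_annulus_iff.mp (hT j hw)).2.1
    have hpow : (b ^ 2) ^ (i + 1) ≤ (b ^ 2) ^ j := Nat.pow_le_pow_right (by positivity) hij
    have hqi : 0 < (b ^ 2) ^ i := by positivity
    rw [pow_succ] at hpow
    nlinarith
  intro v hv w hw hvw
  obtain ⟨i, hi⟩ := Set.mem_iUnion.mp hv
  obtain ⟨j, hj⟩ := Set.mem_iUnion.mp hw
  rcases lt_trichotomy i j with hij | rfl | hij
  · exact hlt hij hi hj
  · exact hsep i hi hj hvw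
  · exact dist_comm v w ▸ hlt hij hj hi

theorem boxCount_iUnion_le (hb : 2 ≤ b) (hT : ∀ k, T k ⊆ annulus S b k) (N : ℕ) :
    boxCount (⋃ k, T k) N ≤ ∑ i ∈ Finset.range (Nat.log (b ^ 2) N + 1), (T i).ncard := by
  have hsub : (⋃ k, T k) ∩ box d N ⊆ ⋃ i ∈ Finset.range (Nat.log (b ^ 2) N + 1), T i := by
    rintro v ⟨hv, hbox⟩
    obtain ⟨k, hk⟩ := Set.mem_iUnion.mp hv
    have hpow : (b ^ 2) ^ k ≤ N := (mem_annulus_iff.mp (hT k hk)).2.1.le.trans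
      (Finset.sup_le fun j _ => (hbox j).2)
    have hlog := Nat.le_log_of_pow_le (Nat.one_lt_pow two_ne_zero hb) hpow
    exact Set.mem_biUnion (Finset.mem_coe.mpr (Finset.mem_range.mpr (Nat.lt_succ_of_le hlog))) hk
  exact (Set.ncard_le_ncard hsub (Set.Finite.biUnion (Finset.finite_toSet _) fun i _ =>
    (annulus_finite S b i).subset (hT i))).trans (Finset.set_ncard_biUnion_le _ _)

theorem boxCount_iUnion_isLittleO (hS : S ⊆ posVec d) (hb : 2 ≤ b)
    (hgrowth : (fun N => (boxCount S (b * N) : ℝ)) =O[atTop] fun N => (boxCount S N : ℝ))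
    (hann : Tendsto (fun k => ((annulus S b k).ncard : ℝ)) atTop atTop)
    (hT : ∀ k, T k ⊆ annulus S b k)
    (hTo : (fun k => ((T k).ncard : ℝ)) =o[atTop] fun k => ((annulus S b k).ncard : ℝ)) :
    (fun N => (boxCount (⋃ k, T k) N : ℝ)) =o[atTop] fun N => (boxCount S N : ℝ) := by
  have hq : 1 < b ^ 2 := Nat.one_lt_pow two_ne_zero hb
  have hsum : Tendsto (fun n => ∑ i ∈ Finset.range n, ((annulus S b i).ncard : ℝ)) atTop atTop := by
    refine (tendsto_add_atTop_iff_nat 1).mp (tendsto_atTop_mono (fun k => ?_) hann)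
    exact Finset.single_le_sum (f := fun i => ((annulus S b i).ncard : ℝ))
      (fun i _ => Nat.cast_nonneg _) (Finset.self_mem_range_succ k)
  have hlog : Tendsto (fun N => Nat.log (b ^ 2) N + 1) atTop atTop :=
    tendsto_atTop.mpr fun k => (eventually_ge_atTop ((b ^ 2) ^ k)).mono fun N hN =>
      (Nat.le_log_of_pow_le hq hN).trans (Nat.le_succ _)
  refine Asymptotics.IsBigO.trans_isLittleO (.of_bound' (Eventually.of_forall fun N => ?_))
    (((hTo.sum_range (fun _ => Nat.cast_nonneg _) hsum).comp_tendsto hlog).trans_isBigO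
      ((Asymptotics.IsBigO.of_bound' ?_).trans hgrowth))
  · simpa only [Function.comp_apply, ← Nat.cast_sum, Real.norm_natCast, Nat.cast_le] using
      boxCount_iUnion_le hb hT N
  · filter_upwards [eventually_ne_atTop 0] with N hN
    simpa only [Function.comp_apply, ← Nat.cast_sum, Real.norm_natCast, Nat.cast_le] using
      (sum_ncard_annulus_le hS (by omega) _).trans
        (boxCount_mono S (Nat.mul_le_mul_left b (Nat.pow_log_le_self _ hN)))

end Annulus

theorem rpow_isLittleO_ncard_annulus {S : Set (Fin d → ℕ)} {b : ℕ} {e : ℝ} (hS : S ⊆ posVec d)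
    (hb : 2 ≤ b) (hdouble : ∀ᶠ N in atTop, 2 * boxCount S N ≤ boxCount S (b * N))
    (hrpow : (fun N : ℕ => (N : ℝ) ^ e) =o[atTop] fun N => (boxCount S N : ℝ)) :
    (fun k => (((b ^ 2) ^ k : ℕ) : ℝ) ^ e) =o[atTop] fun k => ((annulus S b k).ncard : ℝ) := by
  have hq : Tendsto (fun k => (b ^ 2) ^ k) atTop atTop :=
    tendsto_pow_atTop_atTop_of_one_lt (Nat.one_lt_pow two_ne_zero hb)
  refine (hrpow.comp_tendsto hq).trans_isBigO (.of_bound' ((hq.eventually hdouble).mono ?_))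
  intro k hk
  have hadd := boxCount_add_ncard_annulus hS (by omega : 0 < b) k
  rw [Function.comp_apply, Real.norm_natCast, Real.norm_natCast, Nat.cast_le]
  omega

theorem isLittleO_natCeil {ι : Type*} {l : Filter ι} {f g : ι → ℝ} (h : f =o[l] g)
    (hg : Tendsto g l atTop) : (fun i => (⌈f i⌉₊ : ℝ)) =o[l] g := by
  have hone : (fun _ => (1 : ℝ)) =o[l] g :=
    Asymptotics.isLittleO_const_left.mpr (.inr (tendsto_norm_atTop_atTop.comp hg))
  refine Asymptotics.IsBigO.trans_isLittleO (.of_bound' (Eventually.of_forall fun i => ?_))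
    (h.norm_left.add hone)
  rw [Real.norm_natCast, Real.norm_of_nonneg (by positivity)]
  calc (⌈f i⌉₊ : ℝ) ≤ ⌈‖f i‖⌉₊ := by gcongr; exact le_abs_self _
    _ ≤ ‖f i‖ + 1 := (Nat.ceil_lt_add_one (norm_nonneg _)).le

theorem pow_rpow_isLittleO_mul_inv_succ {q e e' : ℝ} (hq : 1 < q) (h : e < e') :
    (fun k : ℕ => (q ^ k) ^ e) =o[atTop] fun k => (q ^ k) ^ e' * ((k + 1 : ℕ) : ℝ)⁻¹ := by
  have hr : 1 < q ^ (e' - e) := Real.one_lt_rpow hq (sub_pos.mpr h)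
  have hsucc : (fun k : ℕ => ((k + 1 : ℕ) : ℝ)) =o[atTop] fun k => (q ^ (e' - e)) ^ k := by
    simp only [Nat.cast_add_one]
    refine (isLittleO_coe_const_pow_of_one_lt hr).add ?_
    simpa only [pow_zero] using isLittleO_pow_const_const_pow_of_one_lt (R := ℝ) 0 hr
  have hinv := hsucc.inv_rev
    (Eventually.of_forall fun k hk => absurd hk (Nat.cast_ne_zero.mpr k.succ_ne_zero))
  refine ((Asymptotics.isBigO_refl (fun k : ℕ => (q ^ k) ^ e') atTop).mul_isLittleO hinv).congr_left
    fun k => ?_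
  have hq0 : 0 < q := one_pos.trans hq
  rw [Real.rpow_pow_comm hq0.le, ← Real.rpow_neg (by positivity), ← Real.rpow_add (by positivity),
    neg_sub, add_sub_cancel]

theorem exists_sparse_subset_annulus {S : Set (Fin d → ℕ)} {b : ℕ} {δ : ℝ} (hb : 2 ≤ b)
    (hann : ∀ e < δ, (fun k => (((b ^ 2) ^ k : ℕ) : ℝ) ^ e) =o[atTop]
      fun k => ((annulus S b k).ncard : ℝ))
    (htop : Tendsto (fun k => ((annulus S b k).ncard : ℝ)) atTop atTop) :
    ∃ T : ℕ → Set (Fin d → ℕ), (∀ k, T k ⊆ annulus S b k) ∧ (∀ k, TwoSeparated (T k)) ∧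
      ((fun k => ((T k).ncard : ℝ)) =o[atTop] fun k => ((annulus S b k).ncard : ℝ)) ∧
      ∀ e < δ, (fun k => (((b ^ 2) ^ k : ℕ) : ℝ) ^ e) =O[atTop] fun k => ((T k).ncard : ℝ) := by
  -- Keeping the fraction `1 / (k + 1)` of the `k`-th annulus makes the union a null part of `S` and
  -- costs no exponent because the radii grow geometrically in `k`.
  choose T hTsub hTsep hTcard using fun k =>
    exists_twoSeparated_subset_card_eq (annulus_finite S b k).toFinset k.succ_ne_zero
  simp only [← Set.ncard_eq_toFinset_card] at hTcard
  refine ⟨fun k => T k, fun k => Set.Finite.subset_toFinset.mp (hTsub k), hTsep, ?_, ?_⟩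
  all_goals simp only [Set.ncard_coe_finset]
  · simp only [hTcard]
    refine isLittleO_natCeil ?_ htop
    have hinv : Tendsto (fun k : ℕ => (2 ^ d * ((k + 1 : ℕ) : ℝ))⁻¹) atTop (𝓝 0) :=
      ((tendsto_natCast_atTop_atTop.comp (tendsto_add_atTop_nat 1)).const_mul_atTop
        (by positivity)).inv_tendsto_atTop
    simpa only [div_eq_mul_inv, mul_one] using
      (Asymptotics.isBigO_refl (fun k => ((annulus S b k).ncard : ℝ)) atTop).mul_isLittleO
        ((Asymptotics.isLittleO_one_iff ℝ).mpr hinv)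
  · intro e he
    obtain ⟨e', hee', he'⟩ := exists_between he
    have hq : (1 : ℝ) < (b ^ 2 : ℕ) := by exact_mod_cast Nat.one_lt_pow two_ne_zero hb
    have hpow := pow_rpow_isLittleO_mul_inv_succ hq hee'
    simp only [← Nat.cast_pow] at hpow
    refine (hpow.isBigO.trans ((hann e' he').isBigO.mul (Asymptotics.isBigO_refl _ _))).trans
      (.of_bound (2 ^ d) (Eventually.of_forall fun k => ?_))
    rw [Real.norm_of_nonneg (by positivity), Real.norm_natCast, ← div_eq_mul_inv,
      ← div_le_iff₀' (by positivity), div_div, mul_comm _ (2 ^ d : ℝ), hTcard]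
    exact Nat.le_ceil _

theorem subset_shell_iUnion {S : Set (Fin d → ℕ)} {b : ℕ} {T : ℕ → Set (Fin d → ℕ)}
    (hb : 2 ≤ b) (hT : ∀ k, T k ⊆ annulus S b k) {M : ℝ} (hM : 1 < M) :
    T (Nat.clog (b ^ 2) ⌈M⌉₊) ⊆ shell (⋃ k, T k) (Set.Ico M ((b ^ 3 : ℕ) * M)) := by
  intro v hv
  have hq : 1 < b ^ 2 := Nat.one_lt_pow two_ne_zero hb
  obtain ⟨-, hlo, hhi⟩ := mem_annulus_iff.mp (hT _ hv)
  have hceil : 1 < ⌈M⌉₊ := Nat.lt_ceil.mpr (by exact_mod_cast hM)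
  have hpred : (b ^ 2) ^ (Nat.clog (b ^ 2) ⌈M⌉₊ - 1) < M := by
    exact_mod_cast Nat.lt_ceil.mp (Nat.pow_pred_clog_lt_self hq hceil)
  have hclog : Nat.clog (b ^ 2) ⌈M⌉₊ ≠ 0 := (Nat.clog_pos hq hceil).ne'
  refine ⟨Set.mem_iUnion.mpr ⟨_, hv⟩, ?_, ?_⟩
  · exact (Nat.le_ceil M).trans (by exact_mod_cast (Nat.le_pow_clog hq _).trans hlo.le)
  · calc (supNorm v : ℝ) ≤ b * (b ^ 2) ^ Nat.clog (b ^ 2) ⌈M⌉₊ := by exact_mod_cast hhi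
      _ = (b ^ 3 : ℕ) * (b ^ 2) ^ (Nat.clog (b ^ 2) ⌈M⌉₊ - 1) := by
        rw [← mul_pow_sub_one hclog]; push_cast; ring
      _ < (b ^ 3 : ℕ) * M := by gcongr

theorem rpow_isBigO_ncard_shell_iUnion {S : Set (Fin d → ℕ)} {b : ℕ} {T : ℕ → Set (Fin d → ℕ)}
    (hb : 2 ≤ b) (hT : ∀ k, T k ⊆ annulus S b k) {e : ℝ} (he : 0 ≤ e)
    (hgrowth : (fun k => (((b ^ 2) ^ k : ℕ) : ℝ) ^ e) =O[atTop] fun k => ((T k).ncard : ℝ)) :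
    (fun M : ℝ => M ^ e) =O[atTop]
      fun M => ((shell (⋃ k, T k) (Set.Ico M ((b ^ 3 : ℕ) * M))).ncard : ℝ) := by
  have hq : 1 < b ^ 2 := Nat.one_lt_pow two_ne_zero hb
  have hclog : Tendsto (Nat.clog (b ^ 2)) atTop atTop := tendsto_atTop.mpr fun k => by
    filter_upwards [eventually_gt_atTop ((b ^ 2) ^ k)] with N hN
    exact ((Nat.lt_clog_iff_pow_lt hq).mpr hN).le
  refine (Asymptotics.IsBigO.of_bound' ?_).trans ((hgrowth.comp_tendsto
    (hclog.comp tendsto_nat_ceil_atTop)).trans (.of_bound' ?_))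
    <;> filter_upwards [eventually_gt_atTop 1] with M hM
  · have : 0 ≤ M := by linarith
    simp only [Function.comp_apply]
    rw [Real.norm_of_nonneg (by positivity), Real.norm_of_nonneg (by positivity)]
    gcongr
    exact (Nat.le_ceil M).trans (by exact_mod_cast Nat.le_pow_clog hq _)
  · simp only [Function.comp_apply]
    rw [Real.norm_natCast, Real.norm_natCast, Nat.cast_le]
    exact Set.ncard_le_ncard (subset_shell_iUnion hb hT hM) (shell_finite _ bddAbove_Ico)

/-- `T` is a relatively null, `2`-separated part of `S` which still has at least `M ^ e` elements,
up to a constant, in every shell `M ≤ ‖v‖ < L * M`, for all exponents `e < δ`. -/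
structure IsThinPart (S T : Set (Fin d → ℕ)) (δ L : ℝ) : Prop where
  one_lt : 1 < L
  subset : T ⊆ S
  relUpperDensity_eq_zero : relUpperDensity T S = 0
  twoSeparated : TwoSeparated T
  rpow_isBigO_ncard_shell : ∀ e, 0 ≤ e → e < δ →
    (fun M : ℝ => M ^ e) =O[atTop] fun M => ((shell T (Set.Ico M (L * M))).ncard : ℝ)

theorem HasPolyDensity.exists_isThinPart [NeZero d] {S : Set (Fin d → ℕ)} {α : ℝ}
    (hS : HasPolyDensity S α) (hSpos : S ⊆ posVec d) (hα : 0 < α) :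
    ∃ (T : Set (Fin d → ℕ)) (L : ℝ), IsThinPart S T (d / α) L := by
  have hδ : 0 < d / α := div_pos (Nat.cast_pos.mpr (NeZero.pos d)) hα
  obtain ⟨b, hb, hdouble⟩ := hS.exists_two_mul_boxCount_le hδ
  have hann : ∀ e < d / α, (fun k => (((b ^ 2) ^ k : ℕ) : ℝ) ^ e) =o[atTop]
      fun k => ((annulus S b k).ncard : ℝ) := fun e he =>
    rpow_isLittleO_ncard_annulus hSpos hb hdouble (hS.rpow_isLittleO_boxCount he)
  have htop : Tendsto (fun k => ((annulus S b k).ncard : ℝ)) atTop atTop := by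
    simpa only [Real.rpow_zero, Asymptotics.isLittleO_one_left_iff, Real.norm_natCast]
      using hann 0 hδ
  obtain ⟨T, hT, hsep, hTo, hgrowth⟩ := exists_sparse_subset_annulus hb hann htop
  refine ⟨⋃ k, T k, (b ^ 3 : ℕ), by exact_mod_cast Nat.one_lt_pow three_ne_zero hb, ?_, ?_,
    twoSeparated_iUnion hb hT hsep, fun e he he' =>
      rpow_isBigO_ncard_shell_iUnion hb hT he (hgrowth e he')⟩
  · exact Set.iUnion_subset fun k => (hT k).trans fun v hv => hv.1
  · exact relUpperDensity_eq_zero_of_isLittleO (boxCount_iUnion_isLittleO hSpos hb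
      (hS.boxCount_mul_isBigO (by omega)) htop hT hTo)

/-! ### Seed sets -/

/-- The vectors admissible as `n`-th digit vector of a point of `seedSet X t L T`. -/
def seedDigits (T : Set (Fin d → ℕ)) (t L : ℝ) (n : ℕ) : Set (Fin d → ℕ) :=
  shell T (Set.Ico (t ^ (n + 1)) (L * t ^ (n + 1)))

section SeedSets

variable {S T : Set (Fin d → ℕ)} {α δ t L K : ℝ}

theorem tendsto_pow_succ_atTop (ht : 1 < t) : Tendsto (fun n : ℕ => t ^ (n + 1)) atTop atTop :=
  (tendsto_pow_atTop_atTop_of_one_lt ht).comp (tendsto_add_atTop_nat 1)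

theorem seedSet_injSpace (ht : 1 < t) (hL : L ≤ t) :
    seedSet (injSpace d) t L T = digitSet (seedDigits T t L) := by
  refine Set.Subset.antisymm (fun x h => ⟨h.1.1, h.2⟩) fun x h =>
    ⟨⟨h.1, fun m n hmn heq => ?_⟩, h.2⟩
  have hmono : StrictMono fun n => supNorm (digitVec x n) := strictMono_nat_of_lt_succ fun n => by
    refine Nat.cast_lt.mp ((h.2 n).2.2.trans_le (le_trans ?_ (h.2 (n + 1)).2.1))
    rw [pow_succ' t (n + 1)]
    gcongr
  exact hmn (hmono.injective (congrArg supNorm heq))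

theorem div_le_of_mem_balanced [NeZero d] (hK : 0 < K) {v : Fin d → ℕ} (hv : v ∈ balanced d K)
    {a : ℝ} (ha : a ≤ supNorm v) (j : Fin d) : a / K ≤ v j := by
  obtain ⟨i, hi⟩ := exists_eq_supNorm v
  rw [div_le_iff₀' hK]
  exact (hi ▸ ha).trans (hv.2 i j)

theorem seedSet_divSpace [NeZero d] (ht : 1 < t) (hK : 0 < K) (hT : T ⊆ balanced d K) :
    seedSet (divSpace d) t L T = digitSet (seedDigits T t L) := by
  refine Set.Subset.antisymm (fun x h => ⟨h.1.1, h.2⟩) fun x h => ⟨⟨h.1, fun j => ?_⟩, h.2⟩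
  exact tendsto_natCast_atTop_iff (R := ℝ).mp (tendsto_atTop_mono
    (fun n => div_le_of_mem_balanced hK (hT (h.2 n).1) (h.2 n).2.1 j)
    ((tendsto_pow_succ_atTop ht).atTop_div_const hK))

theorem ofReal_le_dimH_seedDigits (hT : T ⊆ posVec d) (hsep : TwoSeparated T) (ht : 1 < t)
    (hL : 1 < L) (hne : ∀ n, (seedDigits T t L n).Nonempty)
    (hgrowth : ∀ e, 0 ≤ e → e < δ →
      (fun M : ℝ => M ^ e) =O[atTop] fun M => ((shell T (Set.Ico M (L * M))).ncard : ℝ)) :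
    ENNReal.ofReal (δ / 2) ≤ dimH (digitSet (seedDigits T t L)) := by
  refine ENNReal.le_of_forall_nnreal_lt fun s hs => ?_
  have hs' : 2 * (s : ℝ) < δ := (lt_div_iff₀' two_pos).mp (ENNReal.coe_lt_ofReal.mp hs)
  obtain ⟨e, hse, heδ⟩ := exists_between hs'
  have htop := tendsto_pow_succ_atTop ht
  have hM : ∀ n : ℕ, 1 ≤ t ^ (n + 1) := fun n => one_le_pow₀ ht.le
  have : 0 ≤ 2 * (s : ℝ) := by positivity
  have hcard : (fun n : ℕ => (2 * L * t ^ (n + 1 + 1)) ^ (2 * (s : ℝ))) =o[atTop]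
      fun n => ((seedDigits T t L n).ncard : ℝ) := by
    refine .trans_isBigO ?_ ((hgrowth e (by linarith) heδ).comp_tendsto htop)
    refine (((isLittleO_rpow_rpow_of_lt hse).comp_tendsto htop).const_mul_left
      ((2 * L * t) ^ (2 * (s : ℝ)))).congr_left fun n => ?_
    rw [Function.comp_apply, ← Real.mul_rpow (by positivity) (by positivity), pow_succ' t (n + 1)]
    ring_nf
  refine le_dimH_digitSet (fun n v hv => hT hv.1) hne
    (fun n => Set.Pairwise.mono (fun v hv => hv.1) hsep) (B := fun n => 2 * L * t ^ (n + 1))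
    (fun n => by positivity) (fun n v hv j => ?_) (htop.const_mul_atTop (by positivity)) ?_
  · have hj : (v j : ℝ) ≤ supNorm v := Nat.cast_le.mpr (le_supNorm v j)
    have hlt := hv.2.2
    nlinarith [hM n]
  · filter_upwards [hcard.bound one_pos] with n hn
    rwa [one_mul, Real.norm_natCast, Real.norm_of_nonneg (by positivity)] at hn

theorem dimH_seedDigits_le_ofReal [NeZero d] (hK : 0 < K) (hT : T ⊆ balanced d K) (ht : 1 < t)
    (hδ : 0 ≤ δ) (hcount : ∀ e, δ < e →
      (fun M : ℝ => ((shell T (Set.Ico M (L * M))).ncard : ℝ)) =o[atTop] fun M => M ^ e) :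
    dimH (digitSet (seedDigits T t L)) ≤ ENNReal.ofReal (δ / 2) := by
  refine le_of_forall_gt_imp_ge_of_dense fun r hr => ?_
  obtain ⟨s, hs, hsr⟩ := ENNReal.lt_iff_exists_nnreal_btwn.mp hr
  refine le_trans ?_ hsr.le
  have hs' : δ < 2 * (s : ℝ) :=
    (div_lt_iff₀' two_pos).mp ((ENNReal.ofReal_lt_coe_iff (by positivity)).mp hs)
  have htop := tendsto_pow_succ_atTop ht
  refine dimH_digitSet_le (b := fun n => t ^ (n + 1) / K) (fun n => shell_finite T bddAbove_Ico)
    (fun n => by positivity) (fun n v hv => div_le_of_mem_balanced hK (hT hv.1) hv.2.1)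
    (htop.atTop_div_const hK) ?_
  have hcard := (hcount _ hs').comp_tendsto htop
  filter_upwards [hcard.bound (show 0 < (K ^ (2 * (s : ℝ)))⁻¹ by positivity)] with n hn
  simp only [Function.comp_apply] at hn
  rwa [Real.norm_natCast, Real.norm_of_nonneg (by positivity), ← div_eq_inv_mul,
    ← Real.div_rpow (by positivity) hK.le] at hn

theorem HasPolyDensity.ncard_shell_isLittleO_rpow (hS : HasPolyDensity S α) (hSpos : S ⊆ posVec d)
    (hTS : T ⊆ S) {e : ℝ} (he : d / α < e) (he0 : 0 ≤ e) (hL : 0 < L) :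
    (fun M : ℝ => ((shell T (Set.Ico M (L * M))).ncard : ℝ)) =o[atTop] fun M => M ^ e := by
  have hfloor : Tendsto (fun M : ℝ => ⌊L * M⌋₊) atTop atTop :=
    tendsto_nat_floor_atTop.comp (tendsto_id.const_mul_atTop hL)
  refine (Asymptotics.IsBigO.of_bound' ?_).trans_isLittleO
    (((hS.boxCount_isLittleO_rpow he).comp_tendsto hfloor).trans_isBigO (.of_bound (L ^ e) ?_))
    <;> filter_upwards [eventually_ge_atTop 0] with M hM
  · rw [Function.comp_apply, Real.norm_natCast, Real.norm_natCast, Nat.cast_le,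
      boxCount_eq_ncard_shell hSpos]
    refine Set.ncard_le_ncard (fun v hv => ⟨hTS hv.1, ?_⟩) (shell_finite S bddAbove_Iic)
    exact (Nat.cast_le (α := ℝ)).mpr (Nat.le_floor hv.2.2.le)
  · simp only [Function.comp_apply]
    rw [Real.norm_of_nonneg (by positivity), Real.norm_of_nonneg (by positivity),
      ← Real.mul_rpow hL.le hM]
    gcongr
    exact Nat.floor_le (by positivity)

theorem HasPolyDensity.dimH_seedDigits_le [NeZero d] (hS : HasPolyDensity S α) (hα : 0 ≤ α)
    (hTS : T ⊆ S) (hK : 0 < K) (hSK : S ⊆ balanced d K) (ht : 1 < t) (hL : 0 < L) :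
    dimH (digitSet (seedDigits T t L)) ≤ ENNReal.ofReal (d / (2 * α)) := by
  have hδ : 0 ≤ d / α := by positivity
  rw [mul_comm, ← div_div]
  exact dimH_seedDigits_le_ofReal hK (hTS.trans hSK) ht hδ fun e he =>
    hS.ncard_shell_isLittleO_rpow (fun v hv => (hSK hv).1) hTS he (hδ.trans he.le) hL

namespace IsThinPart

theorem eventually_nonempty_shell (hT : IsThinPart S T δ L) (hδ : 0 < δ) :
    ∀ᶠ M in atTop, (shell T (Set.Ico M (L * M))).Nonempty := by
  filter_upwards [(hT.rpow_isBigO_ncard_shell 0 le_rfl hδ).eq_zero_imp] with M hM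
  refine Set.nonempty_of_ncard_ne_zero fun h => one_ne_zero ((Real.rpow_zero M).symm.trans (hM ?_))
  rw [h, Nat.cast_zero]

theorem infinite (hT : IsThinPart S T δ L) (hδ : 0 < δ) : T.Infinite := fun hfin => by
  obtain ⟨B, hB⟩ := (hfin.image fun v => (supNorm v : ℝ)).bddAbove
  obtain ⟨M, ⟨v, hv⟩, hM⟩ :=
    ((hT.eventually_nonempty_shell hδ).and (eventually_gt_atTop B)).exists
  exact (hM.trans_le hv.2.1).not_ge (hB (Set.mem_image_of_mem _ hv.1))

theorem isExtremeSeedSet [NeZero d] (hT : IsThinPart S T (d / α) L) (hSpos : S ⊆ posVec d)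
    (hS : HasPolyDensity S α) (hα : 1 ≤ α) (hLt : L < t) (hne : ∀ n, (seedDigits T t L n).Nonempty)
    {X : Set (Fin d → ℝ)} (hX : seedSet X t L T = digitSet (seedDigits T t L)) :
    IsExtremeSeedSet X S α t L T := by
  have hδ : 0 < d / α := div_pos (Nat.cast_pos.mpr (NeZero.pos d)) (by positivity)
  have hTpos : T ⊆ posVec d := hT.subset.trans hSpos
  exact {
    infinite_ambient := (hT.infinite hδ).mono hT.subset
    subset := hT.subset
    infinite := hT.infinite hδ
    one_lt := hT.one_lt
    lt := hLt
    nonempty := hX ▸ digitSet_nonempty (fun n v hv => hTpos hv.1) hne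
    one_le := hα
    polyDensity := hS
    twoSeparated := hT.twoSeparated
    relUpperDensity_eq_zero := hT.relUpperDensity_eq_zero
    le_dimH := by
      rw [hX, mul_comm, ← div_div]
      exact ofReal_le_dimH_seedDigits hTpos hT.twoSeparated (hT.one_lt.trans hLt) hT.one_lt hne
        hT.rpow_isBigO_ncard_shell }

end IsThinPart

end SeedSets

end CFSeed

end

theorem proposition5p6 (d : ℕ) (hd : 1 ≤ d) (S : Set (Fin d → ℕ)) (hSpos : S ⊆ CFSeed.posVec d)
    (α : ℝ) (hα : 1 ≤ α) (hS : CFSeed.HasPolyDensity S α) :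
    ∃ Sstar : Set (Fin d → ℕ), Sstar ⊆ S ∧ CFSeed.relUpperDensity Sstar S = 0 ∧
      ∃ L t₀ : ℝ, 1 < L ∧ L < t₀ ∧ ∀ t : ℝ, t₀ ≤ t →
        CFSeed.IsExtremeSeedSet (CFSeed.injSpace d) S α t L Sstar ∧
        ((∃ K : ℝ, 1 ≤ K ∧ S ⊆ CFSeed.balanced d K) →
          dimH (CFSeed.seedSet (CFSeed.injSpace d) t L Sstar)
              = ENNReal.ofReal ((d : ℝ) / (2 * α)) ∧
          CFSeed.IsExtremeSeedSet (CFSeed.divSpace d) S α t L Sstar ∧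
          dimH (CFSeed.seedSet (CFSeed.divSpace d) t L Sstar)
              = ENNReal.ofReal ((d : ℝ) / (2 * α))) := by
  have : NeZero d := ⟨by omega⟩
  have hδ : 0 < d / α := div_pos (Nat.cast_pos.mpr hd) (by positivity)
  obtain ⟨T, L, hT⟩ := hS.exists_isThinPart hSpos (by positivity)
  obtain ⟨t₀, hne, ht₀⟩ := ((eventually_forall_ge_atTop.mpr
    (hT.eventually_nonempty_shell hδ)).and (eventually_gt_atTop L)).exists
  refine ⟨T, hT.subset, hT.relUpperDensity_eq_zero, L, t₀, hT.one_lt, ht₀, fun t ht => ?_⟩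
  have hLt : L < t := ht₀.trans_le ht
  have ht1 : 1 < t := hT.one_lt.trans hLt
  have hne' : ∀ n, (CFSeed.seedDigits T t L n).Nonempty := fun n =>
    hne _ (ht.trans (le_self_pow₀ ht1.le n.succ_ne_zero))
  have hinj := CFSeed.seedSet_injSpace (T := T) ht1 hLt.le
  have hinjExt := hT.isExtremeSeedSet hSpos hS hα hLt hne' hinj
  refine ⟨hinjExt, fun ⟨K, hK, hSK⟩ => ?_⟩
  have hK0 : 0 < K := by positivity
  have hdiv := CFSeed.seedSet_divSpace (L := L) ht1 hK0 (hT.subset.trans hSK)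
  have hdivExt := hT.isExtremeSeedSet hSpos hS hα hLt hne' hdiv
  have hdim := hS.dimH_seedDigits_le (by positivity) hT.subset hK0 hSK ht1 (one_pos.trans hT.one_lt)
  exact ⟨(hinj ▸ hdim).antisymm hinjExt.le_dimH, hdivExt, (hdiv ▸ hdim).antisymm hdivExt.le_dimH⟩
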